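/- **Conventions.** Graphs are finite directed graphs $E=(E^0,E^1,r,s)$ (loops and parallel edges allowed), considered up to isomorphism. $E$ is *essential* if it has neither sinks nor sources. A *graph of Gelfand–Kirillov dimension three* is a connected finite essential graph $E$ whose Leavitt path algebra $L_K(E)$ over a field $K$ has Gelfand–Kirillov dimension $3$. The cycles of such a graph are pairwise disjoint; the *source cycles* $C_1^E,\dots,C_m^E$ are those from which there is a path to another cycle, and the *sink cycles* $D_1^E,\dots,D_n^E$ are those to which there is a path from another cycle. A *trail* is a path $e_1\cdots e_t$ ($t\ge 1$) whose source lies on a source cycle, whose range lies on a sink cycle, and such that $r(e_1),\dots,r(e_{t-1})$ lie on no source cycle and on no sink cycle. $E$ is in *normal form* if every trail consists of exactly one edge and, for each source cycle, all trails starting from it have the same source. An *in-splitting* of $E$ is obtained by choosing, for each $v\in E^0$ with $r^{-1}(v)\neq\emptyset$, a partition of $r^{-1}(v)$ into nonempty sets $\mathscr E^v_1,\dots,\mathscr E^v_{m(v)}$ (put $m(v)=1$ if $r^{-1}(v)=\emptyset$), and forming the graph with vertices $v_i$ $(1\le i\le m(v))$, edges $e_j$ $(1\le j\le m(s(e)))$,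 $s(e_j)=s(e)_j$ and $r(e_j)=r(e)_i$ where $e\in\mathscr E^{r(e)}_i$. *Out-splittings* are defined dually (an in-splitting of the transpose graph, transposed), and *in-* and *out-amalgamations* are the inverse operations. $A_E$ denotes the adjacency matrix of $E$. For square matrices over $\mathbb N$, $A\sim_{SSE}B$ means that there is a finite sequence $A=A_0,A_1,\dots,A_k=B$ of square matrices over $\mathbb N$ such that for each $i$ there are matrices $R,S$ over $\mathbb N$ with $A_i=RS$ and $A_{i+1}=SR$. Index the vertices of each cycle cyclically, modulo its length, in the direction of the cycle. For $E$ in normal form put $p^E_i=|C^E_i|$, $q^E_j=|D^E_j|$, $d^E_{(i,j)}=\gcd(p^E_i,q^E_j)$, and for $c\in\mathbb Z$ let $N^E_{(i,j)}(c)$ be the number of trails that start on $C^E_i$ and end at a vertex of $D^E_j$ whose index is congruent to $c$ modulo $d^E_{(i,j)}$. For graphs $E$, $F$ of Gelfand–Kirillov dimension three in normal form, write $E\approx F$ if they have the same number $m$ of source cycles and the same number $n$ of sink cycles and, for suitable numberings of these cycles, there are integers $a_1,\dots,a_m,b_1,\dots,b_n$ such that $$p^E_i=p^F_i,\qquad q^E_j=q^F_j,\qquad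 N^E_{(i,j)}(c)=N^F_{(i,j)}(c+a_i+b_j)$$ for all $1\le i\le m$, $1\le j\le n$ and $c\in\mathbb N$. (This does not depend on the choice of the indexings.) **Theorem.** Let $E$ and $F$ be graphs of Gelfand–Kirillov dimension three, and let $E'$ and $F'$ be graphs of Gelfand–Kirillov dimension three in normal form that are obtained from $E$ and $F$, respectively, by finite sequences of in-splittings, out-splittings, in-amalgamations and out-amalgamations. Then $$A_E\sim_{SSE}A_F\quad\Longleftrightarrow\quad E'\approx F'.$$ -/

import Mathlib

universe u v

/-- A finite directed graph `(E⁰, E¹, r, s)`; parallel edges and loops are allowed. -/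
structure FinGraph : Type (u + 1) where
  /-- vertices -/
  V : Type u
  /-- edges -/
  Edge : Type u
  [fintypeV : Fintype V]
  [fintypeEdge : Fintype Edge]
  /-- source of an edge -/
  s : Edge → V
  /-- range of an edge -/
  r : Edge → V

attribute [instance] FinGraph.fintypeV FinGraph.fintypeEdge

namespace FinGraph

/-- There is an edge from `a` to `b`. -/
def Step (E : FinGraph.{u}) (a b : E.V) : Prop :=
  ∃ e : E.Edge, E.s e = a ∧ E.r e = b

/-- There is a path (possibly of length zero) from `a` to `b`. -/
def Reaches (E : FinGraph.{u}) : E.V → E.V → Prop :=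
  Relation.ReflTransGen E.Step

/-- Connectedness of the underlying undirected graph (which has to be nonempty). -/
def Connected (E : FinGraph.{u}) : Prop :=
  Nonempty E.V ∧ ∀ a b : E.V, Relation.EqvGen E.Step a b

/-- No sinks and no sources. -/
def Essential (E : FinGraph.{u}) : Prop :=
  (∀ a : E.V, ∃ e : E.Edge, E.s e = a) ∧ ∀ a : E.V, ∃ e : E.Edge, E.r e = a

/-- The transpose graph, with source and range interchanged. -/
def transpose (E : FinGraph.{u}) : FinGraph.{u} where
  V := E.V
  Edge := E.Edge
  s := E.r
  r := E.s

/-- Isomorphism of directed graphs. -/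
structure Iso (E F : FinGraph.{u}) where
  onV : E.V ≃ F.V
  onEdge : E.Edge ≃ F.Edge
  map_s : ∀ e, F.s (onEdge e) = onV (E.s e)
  map_r : ∀ e, F.r (onEdge e) = onV (E.r e)

end FinGraph

/-! ### Square nonnegative integer matrices and strong shift equivalence -/

/-- A square matrix with entries in `ℕ`, indexed by some finite type. -/
structure SqNatMatrix : Type (u + 1) where
  ι : Type u
  [fintype : Fintype ι]
  mat : Matrix ι ι ℕ

attribute [instance] SqNatMatrix.fintype

namespace SqNatMatrix

/-- Elementary (strong) shift equivalence: `A = R S` and `B = S R` with `R`, `S` rectangular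
matrices over `ℕ`. -/
def ElemShiftEquiv (A B : SqNatMatrix.{u}) : Prop :=
  ∃ (R : Matrix A.ι B.ι ℕ) (S : Matrix B.ι A.ι ℕ), A.mat = R * S ∧ B.mat = S * R

/-- Strong shift equivalence: a finite sequence of elementary shift equivalences. -/
def StrongShiftEquiv : SqNatMatrix.{u} → SqNatMatrix.{u} → Prop :=
  Relation.ReflTransGen ElemShiftEquiv

end SqNatMatrix

/-- The adjacency matrix: the `(a, b)` entry is the number of edges from `a` to `b`. -/
noncomputable def FinGraph.adj (E : FinGraph.{u}) : SqNatMatrix.{u} where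
  ι := E.V
  mat := Matrix.of fun a b => Nat.card {e : E.Edge // E.s e = a ∧ E.r e = b}

/-! ### In-splittings and out-splittings -/

namespace FinGraph

/-- The data of an in-splitting.  For a vertex `a` that receives an edge, `r⁻¹(a)` is partitioned
into the `m a` nonempty blocks `{e | r e = a, block e = i}`, `i < m a`.  A vertex that receives no
edge is kept as one vertex, which is recorded by `m a = 1`. -/
structure InSplitData (E : FinGraph.{u}) where
  m : E.V → ℕ
  block : E.Edge → ℕ
  blocks_of_receives : ∀ a, (∃ e, E.r e = a) → ∀ i, i < m a ↔ ∃ e, E.r e = a ∧ block e = i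
  one_of_not_receives : ∀ a, (¬ ∃ e, E.r e = a) → m a = 1

/-- The in-split graph: vertices `a_i` with `i < m a`, edges `e_j` with `j < m (s e)`,
`s (e_j) = (s e)_j` and `r (e_j) = (r e)_i` where `e` is in the block number `i` of `r e`. -/
def InSplitData.graph {E : FinGraph.{u}} (P : E.InSplitData) : FinGraph.{u} where
  V := Σ a : E.V, Fin (P.m a)
  Edge := Σ e : E.Edge, Fin (P.m (E.s e))
  s := fun x => ⟨E.s x.1, x.2⟩
  r := fun x => ⟨E.r x.1, ⟨P.block x.1,
    (P.blocks_of_receives (E.r x.1) ⟨x.1, rfl⟩ (P.block x.1)).2 ⟨x.1, rfl, rfl⟩⟩⟩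

/-- `F` is an in-splitting of `E` (and `E` is an in-amalgamation of `F`). -/
def IsInSplitting (E F : FinGraph.{u}) : Prop :=
  ∃ P : E.InSplitData, Nonempty (Iso P.graph F)

/-- `F` is an out-splitting of `E` (and `E` is an out-amalgamation of `F`). -/
def IsOutSplitting (E F : FinGraph.{u}) : Prop :=
  IsInSplitting E.transpose F.transpose

/-- `F` results from `E` by one in-splitting, in-amalgamation, out-splitting or
out-amalgamation. -/
def Move (E F : FinGraph.{u}) : Prop :=
  IsInSplitting E F ∨ IsInSplitting F E ∨ IsOutSplitting E F ∨ IsOutSplitting F E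

/-- `F` is obtained from `E` by a finite sequence of in-splittings, out-splittings,
in-amalgamations and out-amalgamations. -/
def ObtainedByMoves : FinGraph.{u} → FinGraph.{u} → Prop :=
  Relation.ReflTransGen Move

end FinGraph

/-! ### Leavitt path algebras and Gelfand-Kirillov dimension -/

/-- Generators of the Leavitt path algebra: the vertices, the edges `e` and the ghost
edges `e*`. -/
inductive LeavittGen (E : FinGraph.{u}) : Type u
  | vert (a : E.V)
  | edge (e : E.Edge)
  | ghost (e : E.Edge)

section
variable (K : Type v) [Field K] (E : FinGraph.{u})

/-- A vertex as an element of the free algebra. -/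
def leavittVert (a : E.V) : FreeAlgebra K (LeavittGen E) :=
  FreeAlgebra.ι K (LeavittGen.vert a)

/-- An edge `e` as an element of the free algebra. -/
def leavittEdge (e : E.Edge) : FreeAlgebra K (LeavittGen E) :=
  FreeAlgebra.ι K (LeavittGen.edge e)

/-- A ghost edge `e*` as an element of the free algebra. -/
def leavittGhost (e : E.Edge) : FreeAlgebra K (LeavittGen E) :=
  FreeAlgebra.ι K (LeavittGen.ghost e)

open Classical in
/-- The defining relations of the Leavitt path algebra.  The relation `one` says that the sum of
the vertices, which by the other relations is an identity of the algebra generated by the vertices,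
edges and ghost edges, is the unit of the free unital algebra that the generators are taken in. -/
inductive LeavittRel : FreeAlgebra K (LeavittGen E) → FreeAlgebra K (LeavittGen E) → Prop
  | vert_idem (a : E.V) :
      LeavittRel (leavittVert K E a * leavittVert K E a) (leavittVert K E a)
  | vert_orth (a b : E.V) (h : a ≠ b) :
      LeavittRel (leavittVert K E a * leavittVert K E b) 0
  | source_edge (e : E.Edge) :
      LeavittRel (leavittVert K E (E.s e) * leavittEdge K E e) (leavittEdge K E e)
  | edge_range (e : E.Edge) :
      LeavittRel (leavittEdge K E e * leavittVert K E (E.r e)) (leavittEdge K E e)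
  | ghost_source (e : E.Edge) :
      LeavittRel (leavittGhost K E e * leavittVert K E (E.s e)) (leavittGhost K E e)
  | range_ghost (e : E.Edge) :
      LeavittRel (leavittVert K E (E.r e) * leavittGhost K E e) (leavittGhost K E e)
  | ghost_edge (e : E.Edge) :
      LeavittRel (leavittGhost K E e * leavittEdge K E e) (leavittVert K E (E.r e))
  | ghost_edge_orth (e f : E.Edge) (h : e ≠ f) :
      LeavittRel (leavittGhost K E e * leavittEdge K E f) 0
  | sum_edge_ghost (a : E.V) (h : ∃ e, E.s e = a) :
      LeavittRel (leavittVert K E a)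
        (∑ e ∈ Finset.univ.filter (fun e => E.s e = a), leavittEdge K E e * leavittGhost K E e)
  | one : LeavittRel (∑ a : E.V, leavittVert K E a) 1

/-- The Leavitt path algebra `L_K(E)` of a finite graph. -/
abbrev LeavittPathAlgebra : Type (max u v) := RingQuot (LeavittRel K E)

end

/-- The Gelfand-Kirillov dimension of a `K`-algebra: the supremum, over the finite-dimensional
subspaces `W`, of `limsup log_n (dim (K·1 + W)ⁿ)`.  If `A` is finitely generated, then every
finite-dimensional `W` that generates `A` attains the supremum. -/
noncomputable def gkDim (K : Type u) (A : Type v) [Field K] [Ring A] [Algebra K A] : EReal :=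
  ⨆ W : {W : Submodule K A // W.FG},
    Filter.limsup
      (fun n : ℕ =>
        ((Real.logb n (Module.finrank K ((1 ⊔ W.1) ^ n : Submodule K A)) : ℝ) : EReal))
      Filter.atTop

namespace FinGraph

/-- A graph of Gelfand-Kirillov dimension three: a connected finite essential graph whose Leavitt
path algebra has Gelfand-Kirillov dimension three. -/
def IsGKThree (K : Type v) [Field K] (E : FinGraph.{u}) : Prop :=
  E.Connected ∧ E.Essential ∧ gkDim K (LeavittPathAlgebra K E) = 3

/-! ### Cycles, trails and normal form -/

/-- A cycle together with an indexing of its vertices and edges modulo its length, in the direction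
of the cycle. -/
structure Cycle (E : FinGraph.{u}) where
  len : ℕ
  len_pos : 0 < len
  edge : ZMod len → E.Edge
  chain : ∀ k, E.r (edge k) = E.s (edge (k + 1))
  distinct : Function.Injective fun k => E.s (edge k)

/-- The vertex with index `k`. -/
def Cycle.vertex {E : FinGraph.{u}} (C : E.Cycle) (k : ZMod C.len) : E.V :=
  E.s (C.edge k)

/-- The vertices that lie on the cycle. -/
def Cycle.verts {E : FinGraph.{u}} (C : E.Cycle) : Set E.V :=
  Set.range C.vertex

/-- Two indexed cycles are the same cycle, up to the choice of the indexing. -/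
def Cycle.Same {E : FinGraph.{u}} (C D : E.Cycle) : Prop :=
  Set.range C.edge = Set.range D.edge

/-- There is a path from the cycle `C` to the cycle `D`, and the two are disjoint. -/
def Cycle.LeadsTo {E : FinGraph.{u}} (C D : E.Cycle) : Prop :=
  Disjoint C.verts D.verts ∧ ∃ a ∈ C.verts, ∃ b ∈ D.verts, E.Reaches a b

/-- Source cycles: the cycles from which paths lead to another cycle. -/
def Cycle.IsSource {E : FinGraph.{u}} (C : E.Cycle) : Prop :=
  ∃ D : E.Cycle, C.LeadsTo D

/-- Sink cycles: the cycles to which paths lead from another cycle.  In a graph of Gelfand-Kirillov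
dimension three every cycle is either a source cycle or a sink cycle, and none is both. -/
def Cycle.IsSink {E : FinGraph.{u}} (D : E.Cycle) : Prop :=
  ∃ C : E.Cycle, C.LeadsTo D

/-- The vertex lies on some source cycle. -/
def OnSourceCycle (E : FinGraph.{u}) (a : E.V) : Prop :=
  ∃ C : E.Cycle, C.IsSource ∧ a ∈ C.verts

/-- The vertex lies on some sink cycle. -/
def OnSinkCycle (E : FinGraph.{u}) (a : E.V) : Prop :=
  ∃ D : E.Cycle, D.IsSink ∧ a ∈ D.verts

/-- A trail `e₁ ⋯ e_t`: a path from a source cycle to a sink cycle, all of whose intermediate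
vertices `r e₁, …, r e_{t-1}` lie on no source cycle and on no sink cycle. -/
structure IsTrail (E : FinGraph.{u}) (p : List E.Edge) : Prop where
  ne_nil : p ≠ []
  isPath : p.IsChain (fun e f => E.r e = E.s f)
  source : E.OnSourceCycle (E.s (p.head ne_nil))
  range : E.OnSinkCycle (E.r (p.getLast ne_nil))
  interior : ∀ e ∈ p.dropLast, ¬ E.OnSourceCycle (E.r e) ∧ ¬ E.OnSinkCycle (E.r e)

/-- A graph of Gelfand-Kirillov dimension three in normal form: all trails consist of exactly one
edge, and all trails that start on the same source cycle have the same source. -/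
def InNormalForm (K : Type v) [Field K] (E : FinGraph.{u}) : Prop :=
  E.IsGKThree K ∧
  (∀ p, E.IsTrail p → p.length = 1) ∧
  ∀ C : E.Cycle, C.IsSource → ∀ p q (hp : E.IsTrail p) (hq : E.IsTrail q),
    E.s (p.head hp.ne_nil) ∈ C.verts → E.s (q.head hq.ne_nil) ∈ C.verts →
    E.s (p.head hp.ne_nil) = E.s (q.head hq.ne_nil)

/-! ### The number-theoretic relation -/

/-- For a source cycle `C` and a sink cycle `D`, the number of trails that start on `C` and end at
a vertex of `D` with index congruent to `c` modulo `gcd (|C|, |D|)`.  In a graph in normal form,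
the trails that start on `C` all start at one and the same vertex. -/
noncomputable def trailCount (E : FinGraph.{u}) (C D : E.Cycle) (c : ℤ) : ℕ :=
  Set.ncard {p : List E.Edge | ∃ h : E.IsTrail p,
    E.s (p.head h.ne_nil) ∈ C.verts ∧
    ∃ l : ℤ, E.r (p.getLast h.ne_nil) = D.vertex (l : ZMod D.len) ∧
      l ≡ c [ZMOD (Nat.gcd C.len D.len : ℤ)]}

/-- `C₁, …, C_m` are all the source cycles and `D₁, …, D_n` are all the sink cycles, without
repetition, each with an indexing of its vertices. -/
structure IsPointing (E : FinGraph.{u}) {m n : ℕ} (C : Fin m → E.Cycle) (D : Fin n → E.Cycle) :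
    Prop where
  isSource : ∀ i, (C i).IsSource
  isSink : ∀ j, (D j).IsSink
  all_sources : ∀ X : E.Cycle, X.IsSource → ∃! i, (C i).Same X
  all_sinks : ∀ X : E.Cycle, X.IsSink → ∃! j, (D j).Same X

/-- The relation `E ≈ F`: for suitable numberings of the source cycles and of the sink cycles of
the two graphs, corresponding cycles have equal lengths and the trail counts agree up to shifts
`a_i + b_j`. -/
def Approx (E F : FinGraph.{u}) : Prop :=
  ∃ (m n : ℕ) (C : Fin m → E.Cycle) (D : Fin n → E.Cycle)
    (C' : Fin m → F.Cycle) (D' : Fin n → F.Cycle),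
    E.IsPointing C D ∧ F.IsPointing C' D' ∧
    ∃ (a : Fin m → ℤ) (b : Fin n → ℤ),
      (∀ i, (C i).len = (C' i).len) ∧
      (∀ j, (D j).len = (D' j).len) ∧
      ∀ (c : ℕ) (i : Fin m) (j : Fin n),
        E.trailCount (C i) (D j) c = F.trailCount (C' i) (D' j) (c + a i + b j)

end FinGraph

/-!
Splittings and amalgamations are elementary shift equivalences of adjacency matrices, so the claim
is about graphs `E`, `F` in normal form only.

*Shape of a normal form.*  If a closed path with an exit led to a closed path with an exit, say
`c` with exit path `a`, then `d` with exit edge `b`, then the elements `(c ^ i a d ^ j b)` and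
their adjoints would produce a system of matrix units in the Leavitt path algebra that grows like
`n ^ 4` (`three_lt_gkDim_of_two_loops`), so the Gelfand-Kirillov dimension would exceed `3`.  Hence
cycles are disjoint and no cycle is both a source cycle and a sink cycle
(`FinGraph.IsGKThree.noDoubleExit`, `FinGraph.Cycle.not_isSource_of_isSink`).  A cycle that is
neither is the whole graph, whose algebra has linear growth (`LeavittPathAlgebra.gkDim_le_two`).
In normal form every vertex lies on a cycle and the trails are the edges off the cycles.  So the
adjacency matrix is, up to the order of the vertices, the block matrix `(P, X; 0, Q)` with
permutation matrices `P`, `Q` of one step along the source and the sink cycles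
(`FinGraph.InNormalForm.strongShiftEquiv_layered`).

*Layered matrices.*  From `(P, X + Y; 0, Q) = (1, X; 0, Q) (P, Y; 0, 1)` one sees that
any part of the edges counted by the upper right block can be moved one step along the cycles
simultaneously at both ends, so that only the number of edges in each orbit of the pairs of
vertices matters (`SqNatMatrix.OrbitEquiv.strongShiftEquiv`).  Conversely, a strong shift
equivalence gives an intertwiner `R` over `ℕ` that divides a power.  Its lower left block vanishes,
because otherwise the sum of all entries of `Q R₂₂ = R₂₁ X' + R₂₂ Q'` would be too large on the
right; its diagonal blocks are then permutation matrices; and its upper right block satisfies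
`P R₁₂ + X R₂₂ = R₁₁ X' + R₁₂ Q'`, which on summation over an orbit gives equality of the numbers of
edges (`SqNatMatrix.StrongShiftEquiv.orbitEquiv`).

*Orbits and indices.*  By the Chinese remainder theorem the orbits of pairs of vertices on two
cycles of lengths `p`, `q` are the classes of the difference of the indices modulo `gcd (p, q)`.
As the trails from a given source cycle have a common source, the number of trails in an orbit is
a trail count (`FinGraph.InNormalForm.trailCount_eq`), and the equality of the numbers for all orbits
is the relation `≈`.
-/

/-! ### Permutation matrices and shift equivalence over `ℕ` -/

open Classical in
/-- The `0`-`1` matrix of a bijection `f`, with a `1` in the positions `(a, f a)`. -/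
noncomputable def permMat {α β : Type*} (f : α ≃ β) : Matrix α β ℕ :=
  Matrix.of fun a b => if f a = b then 1 else 0

section permMat
variable {α β γ : Type*}

open Classical in
lemma permMat_apply (f : α ≃ β) (a : α) (b : β) :
    permMat f a b = if f a = b then 1 else 0 := rfl

lemma permMat_mul [Fintype β] (f : α ≃ β) (M : Matrix β γ ℕ) :
    permMat f * M = M.submatrix f id := by
  ext a c
  rw [Matrix.mul_apply, Finset.sum_eq_single (f a)]
  · simp [permMat_apply]
  · intro b _ hb
    simp [permMat_apply, hb.symm]
  · simp

lemma mul_permMat [Fintype α] (M : Matrix γ α ℕ) (f : α ≃ β) :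
    M * permMat f = M.submatrix id f.symm := by
  ext c b
  rw [Matrix.mul_apply, Finset.sum_eq_single (f.symm b)]
  · simp [permMat_apply]
  · intro a _ ha
    rw [permMat_apply, if_neg (fun h => ha (f.eq_symm_apply.2 h)), mul_zero]
  · simp

lemma permMat_refl_mul [Fintype α] (M : Matrix α γ ℕ) : permMat (Equiv.refl α) * M = M := by
  rw [permMat_mul]; rfl

lemma mul_permMat_refl [Fintype α] (M : Matrix γ α ℕ) : M * permMat (Equiv.refl α) = M := by
  rw [mul_permMat]; rfl

/-- Matrices over `ℕ` that are inverse to each other up to permutation matrices are themselves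
permutation matrices. -/
lemma exists_eq_permMat [Fintype α] [Fintype β] {R : Matrix α β ℕ} {U : Matrix β α ℕ}
    {σ : α ≃ α} {τ : β ≃ β} (h : R * U = permMat σ) (h' : U * R = permMat τ) :
    ∃ ρ : α ≃ β, R = permMat ρ := by
  have hRU : ∀ a b a', R a b ≠ 0 → U b a' ≠ 0 → σ a = a' := by
    intro a b a' h1 h2
    by_contra hne
    have := congrFun (congrFun h a) a'
    rw [Matrix.mul_apply, permMat_apply, if_neg hne, Finset.sum_eq_zero_iff] at this
    exact mul_ne_zero h1 h2 (this b (Finset.mem_univ _))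
  have hUR : ∀ b a b', U b a ≠ 0 → R a b' ≠ 0 → τ b = b' := by
    intro b a b' h1 h2
    by_contra hne
    have := congrFun (congrFun h' b) b'
    rw [Matrix.mul_apply, permMat_apply, if_neg hne, Finset.sum_eq_zero_iff] at this
    exact mul_ne_zero h1 h2 (this a (Finset.mem_univ _))
  have hex : ∀ a, ∃ b, R a b * U b (σ a) = 1 := by
    intro a
    have := congrFun (congrFun h a) (σ a)
    rw [Matrix.mul_apply, permMat_apply, if_pos rfl] at this
    by_contra! hcon
    have h2 : ∃ b ∈ Finset.univ, R a b * U b (σ a) ≠ 0 :=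
      Finset.exists_ne_zero_of_sum_ne_zero (by rw [this]; exact one_ne_zero)
    obtain ⟨b, _, hb⟩ := h2
    have h3 := Finset.single_le_sum (f := fun b => R a b * U b (σ a)) (fun _ _ => Nat.zero_le _)
      (Finset.mem_univ b)
    have h4 : R a b * U b (σ a) ≤ 1 := h3.trans this.le
    exact hcon b (by omega)
  choose ρ hρ using hex
  have h1 : ∀ a, R a (ρ a) = 1 := fun a => Nat.eq_one_of_mul_eq_one_right (hρ a)
  have h2 : ∀ a, U (ρ a) (σ a) = 1 := fun a => Nat.eq_one_of_mul_eq_one_left (hρ a)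
  have hinj : Function.Injective ρ := by
    intro a a' haa
    apply σ.injective
    apply hRU a (ρ a) (σ a') (by simp [h1])
    rw [haa]; simp [h2]
  have hsurj : Function.Surjective ρ := by
    intro b
    have := congrFun (congrFun h' (τ.symm b)) b
    rw [Matrix.mul_apply, permMat_apply, if_pos (by simp)] at this
    obtain ⟨a, _, ha⟩ := Finset.exists_ne_zero_of_sum_ne_zero
      (this.trans_ne (one_ne_zero (α := ℕ)))
    have e1 := hUR _ a b (left_ne_zero_of_mul ha) (right_ne_zero_of_mul ha)
    have e2 := hUR _ a (ρ a) (left_ne_zero_of_mul ha) (by simp [h1])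
    exact ⟨a, e2.symm.trans e1⟩
  refine ⟨Equiv.ofBijective ρ ⟨hinj, hsurj⟩, ?_⟩
  ext a b
  rw [permMat_apply]
  by_cases hb : ρ a = b
  · rw [if_pos (show Equiv.ofBijective ρ ⟨hinj, hsurj⟩ a = b from hb), ← hb, h1]
  · rw [if_neg (show ¬ Equiv.ofBijective ρ ⟨hinj, hsurj⟩ a = b from hb)]
    by_contra hne
    have e1 := hUR (ρ a) (σ a) (ρ (σ a)) (by simp [h2]) (by simp [h1])
    obtain ⟨a', rfl⟩ := hsurj b
    obtain ⟨a'', rfl⟩ := σ.surjective a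
    have e2 := hRU (σ a'') (ρ a') (σ a') hne (by simp [h2])
    exact hb (congrArg ρ (σ.injective e2))

end permMat

namespace SqNatMatrix

lemma ElemShiftEquiv.symm {A B : SqNatMatrix.{u}} (h : ElemShiftEquiv A B) :
    ElemShiftEquiv B A := by
  obtain ⟨R, S, h1, h2⟩ := h
  exact ⟨S, R, h2, h1⟩

lemma StrongShiftEquiv.refl (A : SqNatMatrix.{u}) : StrongShiftEquiv A A :=
  Relation.ReflTransGen.refl

lemma StrongShiftEquiv.trans {A B C : SqNatMatrix.{u}} (h : StrongShiftEquiv A B)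
    (h' : StrongShiftEquiv B C) : StrongShiftEquiv A C :=
  Relation.ReflTransGen.trans h h'

lemma StrongShiftEquiv.symm {A B : SqNatMatrix.{u}} (h : StrongShiftEquiv A B) :
    StrongShiftEquiv B A := by
  have : Std.Symm (ElemShiftEquiv.{u}) := ⟨fun _ _ => ElemShiftEquiv.symm⟩
  exact (Relation.ReflTransGen.stdSymm (r := ElemShiftEquiv.{u})).symm _ _ h

lemma ElemShiftEquiv.strong {A B : SqNatMatrix.{u}} (h : ElemShiftEquiv A B) :
    StrongShiftEquiv A B :=
  Relation.ReflTransGen.single h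

lemma elemShiftEquiv_of_reindex {A B : SqNatMatrix.{u}} (e : A.ι ≃ B.ι)
    (h : ∀ a b, B.mat (e a) (e b) = A.mat a b) : ElemShiftEquiv A B := by
  refine ⟨permMat e, permMat e.symm * A.mat, ?_, ?_⟩
  · rw [← Matrix.mul_assoc, permMat_mul]
    ext a b
    rw [Matrix.mul_apply, Finset.sum_eq_single a]
    · simp [permMat_apply]
    · intro c _ hc
      simp [permMat_apply, hc.symm]
    · simp
  · rw [mul_permMat, permMat_mul]
    ext a b
    have := h (e.symm a) (e.symm b)
    simpa using this

open Classical in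
/-- Shift equivalence over `ℕ` with some lag `l`, the form in which strong shift equivalence is
used to extract invariants. -/
lemma StrongShiftEquiv.exists_lag {A B : SqNatMatrix.{u}} (h : StrongShiftEquiv A B) :
    ∃ (l : ℕ) (R : Matrix A.ι B.ι ℕ) (S : Matrix B.ι A.ι ℕ),
      A.mat * R = R * B.mat ∧ S * A.mat = B.mat * S ∧ R * S = A.mat ^ l ∧ S * R = B.mat ^ l := by
  unfold StrongShiftEquiv at h
  induction h with
  | refl => exact ⟨0, 1, 1, by simp, by simp, by simp, by simp⟩
  | @tail B C _ hBC ih =>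
    obtain ⟨l, R, S, h1, h2, h3, h4⟩ := ih
    obtain ⟨R', S', hB, hC⟩ := hBC
    have hpow : S' * B.mat ^ l = C.mat ^ l * S' := by
      have : ∀ l : ℕ, S' * B.mat ^ l = C.mat ^ l * S' := by
        intro l
        induction l with
        | zero => simp
        | succ l ih =>
          rw [pow_succ, ← Matrix.mul_assoc, ih, Matrix.mul_assoc, pow_succ, Matrix.mul_assoc,
            hB, hC, Matrix.mul_assoc]
      exact this l
    refine ⟨l + 1, R * R', S' * S, ?_, ?_, ?_, ?_⟩
    · rw [← Matrix.mul_assoc, h1, hB, hC]; simp only [Matrix.mul_assoc]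
    · rw [Matrix.mul_assoc, h2, hB, hC]; simp only [Matrix.mul_assoc]
    · calc R * R' * (S' * S) = R * (R' * S') * S := by simp only [Matrix.mul_assoc]
        _ = A.mat * (R * S) := by rw [← hB, ← h1, Matrix.mul_assoc]
        _ = _ := by rw [h3, pow_succ']
    · calc S' * S * (R * R') = S' * (S * R) * R' := by simp only [Matrix.mul_assoc]
        _ = C.mat ^ l * (S' * R') := by rw [h4, hpow, Matrix.mul_assoc]
        _ = _ := by rw [← hC, pow_succ]

lemma StrongShiftEquiv.exists_lag_matrix {α β : Type u} [Fintype α] [Fintype β] [DecidableEq α]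
    [DecidableEq β] {a : Matrix α α ℕ} {b : Matrix β β ℕ}
    (h : StrongShiftEquiv (⟨α, a⟩ : SqNatMatrix.{u}) ⟨β, b⟩) :
    ∃ (l : ℕ) (R : Matrix α β ℕ) (S : Matrix β α ℕ),
      a * R = R * b ∧ S * a = b * S ∧ R * S = a ^ l ∧ S * R = b ^ l := by
  obtain ⟨l, R, S, h1, h2, h3, h4⟩ := h.exists_lag
  refine ⟨l, R, S, h1, h2, ?_, ?_⟩
  · convert (show (R * S : Matrix α α ℕ) = _ from h3)
  · convert (show (S * R : Matrix β β ℕ) = _ from h4)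

lemma elemShiftEquiv_mk {α β : Type u} [Fintype α] [Fintype β] {a : Matrix α α ℕ}
    {b : Matrix β β ℕ} (R : Matrix α β ℕ) (S : Matrix β α ℕ) (h : a = R * S) (h' : b = S * R) :
    ElemShiftEquiv (⟨α, a⟩ : SqNatMatrix.{u}) ⟨β, b⟩ :=
  ⟨R, S, h, h'⟩

end SqNatMatrix

/-! ### Splittings and amalgamations preserve the strong shift equivalence class -/

namespace FinGraph
open SqNatMatrix

lemma Iso.elemShiftEquiv {E F : FinGraph.{u}} (i : Iso E F) : ElemShiftEquiv E.adj F.adj := by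
  refine elemShiftEquiv_of_reindex (A := E.adj) (B := F.adj) i.onV fun a b => ?_
  refine (Nat.card_congr (i.onEdge.subtypeEquiv fun e => ?_)).symm
  rw [i.map_s, i.map_r]
  exact and_congr i.onV.injective.eq_iff.symm i.onV.injective.eq_iff.symm

/-- `R` counts the edges according to the block in which they end, and `S` forgets the block. -/
lemma InSplitData.elemShiftEquiv {E : FinGraph.{u}} (P : E.InSplitData) :
    ElemShiftEquiv E.adj P.graph.adj := by
  classical
  let R : Matrix E.V (Σ a : E.V, Fin (P.m a)) ℕ := Matrix.of fun a x =>
    Nat.card {e : E.Edge // E.s e = a ∧ E.r e = x.1 ∧ P.block e = x.2}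
  let S : Matrix (Σ a : E.V, Fin (P.m a)) E.V ℕ := Matrix.of fun x b => if x.1 = b then 1 else 0
  refine ⟨R, S, ?_, ?_⟩
  · refine Matrix.ext fun (a : E.V) (b : E.V) => ?_
    change Nat.card _ = ∑ x : (Σ a : E.V, Fin (P.m a)), Nat.card _ * (if x.1 = b then 1 else 0)
    rw [Fintype.sum_sigma, Finset.sum_eq_single b]
    · simp only [if_true, mul_one]
      rw [← Nat.card_sigma]
      refine Nat.card_congr
        { toFun := fun e => ⟨⟨P.block e.1, (P.blocks_of_receives b ⟨e.1, e.2.2⟩ _).2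
            ⟨e.1, e.2.2, rfl⟩⟩, ⟨e.1, e.2.1, e.2.2, rfl⟩⟩
          invFun := fun y => ⟨y.2.1, y.2.2.1, y.2.2.2.1⟩
          left_inv := fun e => rfl
          right_inv := ?_ }
      rintro ⟨⟨i, hi⟩, ⟨e, h1, h2, h3⟩⟩
      dsimp only at h3
      subst h3
      rfl
    · intro c _ hc
      simp [hc]
    · simp
  · refine Matrix.ext fun ⟨a, j⟩ ⟨b, i⟩ => ?_
    change Nat.card _ = ∑ c : E.V, (if a = c then 1 else 0) * R c ⟨b, i⟩
    simp only [ite_mul, one_mul, zero_mul, Finset.sum_ite_eq, Finset.mem_univ, if_true]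
    refine Nat.card_congr
      { toFun := fun e => ⟨e.1.1, congrArg Sigma.fst e.2.1, congrArg Sigma.fst e.2.2, ?_⟩
        invFun := fun e => ⟨⟨e.1, ⟨j.1, by rw [e.2.1]; exact j.2⟩⟩, ?_, ?_⟩
        left_inv := ?_
        right_inv := fun e => rfl }
    · obtain ⟨⟨e, k⟩, h1, h2⟩ := e
      change (⟨E.r e, _⟩ : Σ a : E.V, Fin (P.m a)) = ⟨b, i⟩ at h2
      obtain ⟨rfl, h3⟩ := Sigma.mk.inj_iff.1 h2
      exact congrArg Fin.val (eq_of_heq h3)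
    · obtain ⟨e, rfl, h2, h3⟩ := e
      rfl
    · obtain ⟨e, rfl, h2, h3⟩ := e
      dsimp only at h2 h3
      subst h2
      change (⟨E.r e, _⟩ : Σ a : E.V, Fin (P.m a)) = ⟨E.r e, i⟩
      congr 1
      exact Fin.ext h3
    · rintro ⟨⟨e, k⟩, h1, h2⟩
      change (⟨E.s e, k⟩ : Σ a : E.V, Fin (P.m a)) = ⟨a, j⟩ at h1
      obtain ⟨rfl, h3⟩ := Sigma.mk.inj_iff.1 h1
      obtain rfl := eq_of_heq h3
      rfl

lemma IsInSplitting.strongShiftEquiv {E F : FinGraph.{u}} (h : IsInSplitting E F) :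
    StrongShiftEquiv E.adj F.adj := by
  obtain ⟨P, ⟨i⟩⟩ := h
  exact P.elemShiftEquiv.strong.trans i.elemShiftEquiv.strong

lemma adj_transpose_mat (E : FinGraph.{u}) : E.transpose.adj.mat = E.adj.mat.transpose := by
  ext a b
  exact Nat.card_congr (Equiv.subtypeEquivRight fun e => And.comm)

/-- Strong shift equivalence is compatible with transposition. -/
lemma _root_.SqNatMatrix.StrongShiftEquiv.transpose {A B : SqNatMatrix.{u}}
    (h : StrongShiftEquiv A B) :
    StrongShiftEquiv ⟨A.ι, A.mat.transpose⟩ ⟨B.ι, B.mat.transpose⟩ := by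
  refine Relation.ReflTransGen.lift (r := ElemShiftEquiv)
    (fun A : SqNatMatrix.{u} => (⟨A.ι, A.mat.transpose⟩ : SqNatMatrix.{u})) ?_ _ _ h
  rintro A B ⟨R, S, h1, h2⟩
  refine ⟨S.transpose, R.transpose, ?_, ?_⟩
  · change A.mat.transpose = _
    rw [h1, Matrix.transpose_mul]
  · change B.mat.transpose = _
    rw [h2, Matrix.transpose_mul]

lemma IsOutSplitting.strongShiftEquiv {E F : FinGraph.{u}} (h : IsOutSplitting E F) :
    StrongShiftEquiv E.adj F.adj := by
  have h := (IsInSplitting.strongShiftEquiv h).transpose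
  rw [adj_transpose_mat, adj_transpose_mat] at h
  exact h

lemma ObtainedByMoves.strongShiftEquiv {E F : FinGraph.{u}} (h : ObtainedByMoves E F) :
    StrongShiftEquiv E.adj F.adj := by
  unfold ObtainedByMoves at h
  induction h with
  | refl => exact .refl _
  | tail _ hm ih =>
    refine ih.trans ?_
    rcases hm with h | h | h | h
    · exact h.strongShiftEquiv
    · exact h.strongShiftEquiv.symm
    · exact h.strongShiftEquiv
    · exact h.strongShiftEquiv.symm

end FinGraph

/-! ### Two layers of disjoint cycles -/

open Equiv.Perm (SameCycle)

section countMat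
variable {S T N : Type*}

/-- The rectangular matrix that counts edges: an edge `n` has its source and its range recorded
by `g n`. -/
noncomputable def countMat (g : N → S × T) : Matrix S T ℕ :=
  Matrix.of fun s t => Nat.card {n // g n = (s, t)}

lemma countMat_apply (g : N → S × T) (s : S) (t : T) :
    countMat g s t = Nat.card {n // g n = (s, t)} := rfl

open Classical in
lemma countMat_eq_sum [Fintype N] (g : N → S × T) (s : S) (t : T) :
    countMat g s t = ∑ n, if g n = (s, t) then 1 else 0 := by
  rw [countMat_apply, Nat.card_eq_fintype_card, Fintype.card_subtype, Finset.card_filter]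

lemma countMat_ne_zero [Finite N] (g : N → S × T) (n : N) : countMat g (g n).1 (g n).2 ≠ 0 := by
  rw [countMat_apply]
  have : Nonempty {k // g k = ((g n).1, (g n).2)} := ⟨⟨n, rfl⟩⟩
  exact Nat.card_pos.ne'

lemma sum_card_fiber {α : Type*} [Fintype N] [Fintype α] (g : N → α) (p : α → Prop)
    [DecidablePred p] :
    ∑ x ∈ Finset.univ.filter p, Nat.card {n // g n = x} = Nat.card {n // p (g n)} := by
  classical
  simp only [Nat.card_eq_fintype_card, Fintype.card_subtype]
  rw [Finset.card_eq_sum_card_fiberwise (f := g) (t := Finset.univ.filter p)]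
  · refine Finset.sum_congr rfl fun x hx => ?_
    congr 1
    ext n
    simp only [Finset.mem_filter, Finset.mem_univ, true_and] at hx ⊢
    exact ⟨fun h => ⟨h ▸ hx, h⟩, fun h => h.2⟩
  · intro n hn
    simpa using hn

end countMat

namespace SqNatMatrix

section layered
variable {S T : Type u} [Fintype S] [Fintype T]

/-- The adjacency matrix of a graph whose vertices form two layers `S` and `T`, each a disjoint
union of cycles (the orbits of `σ` and of `τ`), with further edges from `S` to `T` that are counted
by `X`. -/
noncomputable def layered (σ : Equiv.Perm S) (τ : Equiv.Perm T) (X : Matrix S T ℕ) :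
    SqNatMatrix.{u} where
  ι := S ⊕ T
  mat := Matrix.fromBlocks (permMat σ) X 0 (permMat τ)

variable (σ : Equiv.Perm S) (τ : Equiv.Perm T)

lemma elemShiftEquiv_layered_add (X Y : Matrix S T ℕ) :
    ElemShiftEquiv (layered σ τ (X + Y))
      (layered σ τ (X.submatrix σ id + Y.submatrix id τ.symm)) := by
  refine elemShiftEquiv_mk (Matrix.fromBlocks (permMat (Equiv.refl S)) X 0 (permMat τ))
    (Matrix.fromBlocks (permMat σ) Y 0 (permMat (Equiv.refl T))) ?_ ?_
  · rw [Matrix.fromBlocks_multiply]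
    simp [permMat_refl_mul, mul_permMat_refl, add_comm]
  · rw [Matrix.fromBlocks_multiply]
    rw [permMat_mul σ X, mul_permMat Y τ, mul_permMat_refl, permMat_refl_mul]
    simp [permMat_refl_mul]

/-- Any part of the edges between the layers can be moved one step against the direction of the
cycles, at both of its ends. -/
lemma strongShiftEquiv_layered_add (X Y : Matrix S T ℕ) :
    StrongShiftEquiv (layered σ τ (X + Y)) (layered σ τ (X.submatrix σ τ + Y)) := by
  -- the first equivalence moves the sources of the edges in `X` one step back and the ranges of
  -- those in `Y` one step forward; the second moves the ranges of all edges one step back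
  refine (elemShiftEquiv_layered_add σ τ X Y).strong.trans ?_
  have h := elemShiftEquiv_layered_add σ τ 0 (X.submatrix σ τ + Y)
  have e : X.submatrix σ id + Y.submatrix id τ.symm = (0 : Matrix S T ℕ).submatrix σ id +
      (X.submatrix σ τ + Y).submatrix id τ.symm := by
    ext s t
    simp
  rw [← e, zero_add] at h
  exact h.symm.strong

variable {N : Type*} [Fintype N]

lemma strongShiftEquiv_layered_update [DecidableEq N] (g : N → S × T) (n : N) :
    StrongShiftEquiv (layered σ τ (countMat g))
      (layered σ τ (countMat (Function.update g n ((Equiv.prodCongr σ τ).symm (g n))))) := by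
  classical
  let X : Matrix S T ℕ := Matrix.of fun s t => if g n = (s, t) then 1 else 0
  let Y : Matrix S T ℕ := Matrix.of fun s t =>
    ∑ k ∈ Finset.univ.erase n, if g k = (s, t) then 1 else 0
  have h := strongShiftEquiv_layered_add σ τ X Y
  have h1 : X + Y = countMat g := by
    ext s t
    rw [countMat_eq_sum, ← Finset.add_sum_erase _ _ (Finset.mem_univ n)]
    rfl
  have h2 : X.submatrix σ τ + Y =
      countMat (Function.update g n ((Equiv.prodCongr σ τ).symm (g n))) := by
    ext s t
    rw [countMat_eq_sum, ← Finset.add_sum_erase _ _ (Finset.mem_univ n), Matrix.add_apply]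
    congr 1
    · rw [Function.update_self, Matrix.submatrix_apply]
      change (if g n = Equiv.prodCongr σ τ (s, t) then 1 else 0) = _
      simp only [Equiv.symm_apply_eq]
    · refine Finset.sum_congr rfl fun k hk => ?_
      rw [Function.update_of_ne (Finset.ne_of_mem_erase hk)]
  rwa [h1, h2] at h

lemma strongShiftEquiv_layered_update_sameCycle [DecidableEq N] (g : N → S × T) (n : N)
    {x : S × T} (hx : SameCycle (Equiv.prodCongr σ τ : Equiv.Perm (S × T)) x (g n)) :
    StrongShiftEquiv (layered σ τ (countMat g))
      (layered σ τ (countMat (Function.update g n x))) := by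
  obtain ⟨i, hi⟩ := hx.exists_nat_pow_eq
  induction i generalizing g with
  | zero =>
    have : x = g n := hi
    rw [this, Function.update_eq_self]
    exact .refl _
  | succ i ih =>
    have h := strongShiftEquiv_layered_update σ τ g n
    have hi' : ((Equiv.prodCongr σ τ : Equiv.Perm (S × T)) ^ i) x =
        (Equiv.prodCongr σ τ).symm (g n) := by
      rw [Equiv.eq_symm_apply, ← hi, pow_succ', Equiv.Perm.mul_apply]
    have h2 := ih (Function.update g n ((Equiv.prodCongr σ τ).symm (g n)))
      (by rw [Function.update_self]; exact hi' ▸ ⟨i, by simp⟩)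
      (by rw [Function.update_self]; exact hi')
    rw [Function.update_idem] at h2
    exact h.trans h2

/-- Moving the edges between the layers along the orbits of `σ × τ` does not change the strong
shift equivalence class. -/
lemma strongShiftEquiv_layered_of_sameCycle (g g' : N → S × T)
    (h : ∀ n, SameCycle (Equiv.prodCongr σ τ : Equiv.Perm (S × T)) (g' n) (g n)) :
    StrongShiftEquiv (layered σ τ (countMat g)) (layered σ τ (countMat g')) := by
  classical
  suffices H : ∀ s : Finset N, StrongShiftEquiv (layered σ τ (countMat g))
      (layered σ τ (countMat (s.piecewise g' g))) by
    simpa using H Finset.univ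
  intro s
  induction s using Finset.induction_on with
  | empty => simpa using .refl _
  | insert n s hn ih =>
    refine ih.trans ?_
    rw [Finset.piecewise_insert]
    apply strongShiftEquiv_layered_update_sameCycle
    rw [Finset.piecewise_eq_of_notMem _ _ _ hn]
    exact h n

end layered

section layered₂
variable {S T S' T' : Type u} [Fintype S] [Fintype T] [Fintype S'] [Fintype T']
  {N N' : Type*} [Fintype N] [Fintype N']

/-- Two layered graphs agree up to moving edges along orbits: there are bijections of the layers
that commute with the permutations, such that every orbit of `σ' × τ'` contains the same number
of edges on both sides. -/
def OrbitEquiv (σ : Equiv.Perm S) (τ : Equiv.Perm T) (g : N → S × T)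
    (σ' : Equiv.Perm S') (τ' : Equiv.Perm T') (g' : N' → S' × T') : Prop :=
  ∃ (ρ : S ≃ S') (κ : T ≃ T'), (∀ s, ρ (σ s) = σ' (ρ s)) ∧ (∀ t, κ (τ t) = τ' (κ t)) ∧
    ∀ z : S' × T',
      Nat.card {n // SameCycle (Equiv.prodCongr σ' τ' : Equiv.Perm (S' × T'))
        (ρ (g n).1, κ (g n).2) z} =
      Nat.card {n // SameCycle (Equiv.prodCongr σ' τ' : Equiv.Perm (S' × T')) (g' n) z}

lemma exists_equiv_of_card_fiber {α : Type*} (f : N → α) (f' : N' → α)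
    (h : ∀ a, Nat.card {n // f n = a} = Nat.card {n // f' n = a}) :
    ∃ θ : N ≃ N', ∀ n, f' (θ n) = f n := by
  have e : ∀ a, Nonempty ({n // f n = a} ≃ {n // f' n = a}) := fun a =>
    by
    classical exact ⟨Fintype.equivOfCardEq (by simpa only [Nat.card_eq_fintype_card] using h a)⟩
  replace e := fun a => (e a).some
  refine ⟨((Equiv.sigmaFiberEquiv f).symm.trans (Equiv.sigmaCongrRight e)).trans
    (Equiv.sigmaFiberEquiv f'), fun n => ?_⟩
  exact (e (f n) ⟨n, rfl⟩).2

variable {σ : Equiv.Perm S} {τ : Equiv.Perm T} {g : N → S × T}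
    {σ' : Equiv.Perm S'} {τ' : Equiv.Perm T'} {g' : N' → S' × T'}

lemma OrbitEquiv.strongShiftEquiv (h : OrbitEquiv σ τ g σ' τ' g') :
    StrongShiftEquiv (layered σ τ (countMat g)) (layered σ' τ' (countMat g')) := by
  obtain ⟨ρ, κ, hρ, hκ, hz⟩ := h
  let st := SameCycle.setoid (Equiv.prodCongr σ' τ' : Equiv.Perm (S' × T'))
  obtain ⟨θ, hθ⟩ := exists_equiv_of_card_fiber
    (fun n => (Quotient.mk st (ρ (g n).1, κ (g n).2))) (fun n => Quotient.mk st (g' n)) (by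
      intro a
      induction a using Quotient.inductionOn with
      | h z =>
        simp only [Quotient.eq]
        exact hz z)
  have h1 : ElemShiftEquiv (layered σ τ (countMat g))
      (layered σ' τ' (countMat fun n => (ρ (g n).1, κ (g n).2))) := by
    refine elemShiftEquiv_of_reindex (A := layered σ τ (countMat g))
      (B := layered σ' τ' (countMat fun n => (ρ (g n).1, κ (g n).2))) (Equiv.sumCongr ρ κ) ?_
    rintro (s | t) (s' | t')
    · change permMat σ' (ρ s) (ρ s') = permMat σ s s'
      rw [permMat_apply, permMat_apply, ← hρ, ρ.injective.eq_iff]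
    · change countMat _ (ρ s) (κ t') = countMat _ s t'
      rw [countMat_apply, countMat_apply]
      refine Nat.card_congr (Equiv.subtypeEquivRight fun n => ?_)
      simp [Prod.ext_iff]
    · rfl
    · change permMat τ' (κ t) (κ t') = permMat τ t t'
      rw [permMat_apply, permMat_apply, ← hκ, κ.injective.eq_iff]
  have h2 := strongShiftEquiv_layered_of_sameCycle σ' τ' (fun n => (ρ (g n).1, κ (g n).2))
    (fun n => g' (θ n)) (fun n => Quotient.exact (hθ n))
  have h3 : countMat (fun n => g' (θ n)) = countMat g' := by
    ext s t
    exact Nat.card_congr (θ.subtypeEquiv fun n => Iff.rfl)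
  rw [h3] at h2
  exact h1.strong.trans h2

lemma permMat_pow {α : Type*} [Fintype α] [DecidableEq α] (f : Equiv.Perm α) (l : ℕ) :
    permMat f ^ l = permMat (f ^ l) := by
  induction l with
  | zero =>
    ext a b
    simp only [pow_zero, Matrix.one_apply, permMat_apply, Equiv.Perm.one_apply]
    congr
  | succ l ih =>
    rw [pow_succ', ih, permMat_mul]
    ext a b
    rw [Matrix.submatrix_apply, pow_succ, permMat_apply, permMat_apply, Equiv.Perm.mul_apply, id]

lemma fromBlocks_permMat_pow [DecidableEq S] [DecidableEq T] (X : Matrix S T ℕ) (l : ℕ) :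
    ∃ Y : Matrix S T ℕ, Matrix.fromBlocks (permMat σ) X 0 (permMat τ) ^ l =
      Matrix.fromBlocks (permMat (σ ^ l)) Y 0 (permMat (τ ^ l)) := by
  induction l with
  | zero =>
    refine ⟨0, ?_⟩
    rw [← permMat_pow, ← permMat_pow]
    simp [Matrix.fromBlocks_one]
  | succ l ih =>
    obtain ⟨Y, hY⟩ := ih
    rw [pow_succ, hY, Matrix.fromBlocks_multiply, ← permMat_pow, ← permMat_pow, ← permMat_pow,
      ← permMat_pow]
    refine ⟨permMat σ ^ l * X + Y * permMat τ, ?_⟩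
    simp [pow_succ]

/-- An intertwiner of two layered matrices vanishes on `T × S'`: its block there is invariant
under moving along the cycles, while the edges that leave the layer `S'` would make the total sum
of the entries in the block on `T × T'` grow. -/
lemma lower_left_eq_zero {X' : Matrix S' T' ℕ} {R21 : Matrix T S' ℕ} {R22 : Matrix T T' ℕ}
    (hX' : ∀ s, ∃ (i : ℕ) (t : T'), X' ((σ' ^ i) s) t ≠ 0)
    (h1 : permMat τ * R21 = R21 * permMat σ')
    (h2 : permMat τ * R22 = R21 * X' + R22 * permMat τ') : R21 = 0 := by
  have hzero : ∀ t t', (R21 * X') t t' = 0 := by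
    have hsum : ∑ t, ∑ t', (R21 * X') t t' = 0 := by
      have e : ∑ t, ∑ t', (permMat τ * R22) t t' =
          ∑ t, ∑ t', (R21 * X' + R22 * permMat τ') t t' := by rw [h2]
      rw [permMat_mul, mul_permMat] at e
      simp only [Matrix.add_apply, Matrix.submatrix_apply, id, Finset.sum_add_distrib] at e
      rw [Equiv.sum_comp τ (fun t => ∑ t', R22 t t')] at e
      simp only [Equiv.sum_comp τ'.symm] at e
      omega
    intro t t'
    rw [Finset.sum_eq_zero_iff] at hsum
    exact (Finset.sum_eq_zero_iff.1 (hsum t (Finset.mem_univ _))) t' (Finset.mem_univ _)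
  have hprod : ∀ t s t', R21 t s * X' s t' = 0 := fun t s t' => by
    have := hzero t t'
    rw [Matrix.mul_apply, Finset.sum_eq_zero_iff] at this
    exact this s (Finset.mem_univ _)
  have hinv : ∀ t s, R21 (τ t) (σ' s) = R21 t s := by
    intro t s
    have := congrFun (congrFun h1 t) (σ' s)
    rw [permMat_mul, mul_permMat] at this
    simpa using this
  have hinv' : ∀ (i : ℕ) t s, R21 ((τ ^ i) t) ((σ' ^ i) s) = R21 t s := by
    intro i t s
    induction i with
    | zero => simp
    | succ i ih => rw [pow_succ', pow_succ', Equiv.Perm.mul_apply, Equiv.Perm.mul_apply, hinv, ih]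
  ext t s
  obtain ⟨i, t', hi⟩ := hX' s
  rw [← hinv' i]
  exact (Nat.mul_eq_zero.1 (hprod _ _ _)).resolve_right hi

/-- A strong shift equivalence of layered graphs, in which every cycle of the first layer emits an
edge to the second, preserves the number of edges in every orbit: an intertwiner `R` restricts to
bijections of the layers, and its upper right block witnesses that the edges may be moved. -/
lemma StrongShiftEquiv.orbitEquiv
    (hg : ∀ s, ∃ (i : ℕ) (n : N), (g n).1 = (σ ^ i) s)
    (hg' : ∀ s, ∃ (i : ℕ) (n : N'), (g' n).1 = (σ' ^ i) s)
    (h : StrongShiftEquiv (layered σ τ (countMat g)) (layered σ' τ' (countMat g'))) :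
    OrbitEquiv σ τ g σ' τ' g' := by
  classical
  obtain ⟨l, R, U, hAR, hUA, hRU', hUR'⟩ := h.exists_lag_matrix
  obtain ⟨Y, hY⟩ := fromBlocks_permMat_pow (σ := σ) (τ := τ) (countMat g) l
  obtain ⟨Y', hY'⟩ := fromBlocks_permMat_pow (σ := σ') (τ := τ') (countMat g') l
  rw [hY] at hRU'
  rw [hY'] at hUR'
  obtain ⟨R11, R12, R21, R22, rfl⟩ : ∃ R11 R12 R21 R22, R = Matrix.fromBlocks R11 R12 R21 R22 :=
    ⟨_, _, _, _, (Matrix.fromBlocks_toBlocks R).symm⟩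
  obtain ⟨U11, U12, U21, U22, rfl⟩ : ∃ U11 U12 U21 U22, U = Matrix.fromBlocks U11 U12 U21 U22 :=
    ⟨_, _, _, _, (Matrix.fromBlocks_toBlocks U).symm⟩
  simp only [Matrix.fromBlocks_multiply, Matrix.fromBlocks_inj, Matrix.zero_mul, Matrix.mul_zero,
    zero_add, add_zero] at hAR hUA hRU' hUR'
  obtain ⟨hA1, hA2, hA3, hA4⟩ := hAR
  obtain ⟨hU1, hU2, hU3, hU4⟩ := hUA
  have hR21 : R21 = 0 := lower_left_eq_zero (fun s => by
    obtain ⟨i, n, hn⟩ := hg' s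
    exact ⟨i, (g' n).2, hn ▸ countMat_ne_zero g' n⟩) hA3 hA4
  have hU21 : U21 = 0 := lower_left_eq_zero (fun s => by
    obtain ⟨i, n, hn⟩ := hg s
    exact ⟨i, (g n).2, hn ▸ countMat_ne_zero g n⟩) hU3.symm hU4.symm
  subst hR21
  subst hU21
  simp only [Matrix.zero_mul, Matrix.mul_zero, zero_add, add_zero] at hA1 hA2 hA4 hRU' hUR'
  obtain ⟨ρ, rfl⟩ := exists_eq_permMat hRU'.1 hUR'.1
  obtain ⟨κ, rfl⟩ := exists_eq_permMat hRU'.2.2.2 hUR'.2.2.2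
  have hρ : ∀ s, ρ (σ s) = σ' (ρ s) := by
    intro s
    have := congrFun (congrFun hA1 s) (σ' (ρ s))
    rw [permMat_mul, mul_permMat] at this
    by_contra hcon
    simp [permMat_apply, hcon] at this
  have hκ : ∀ t, κ (τ t) = τ' (κ t) := by
    intro t
    have := congrFun (congrFun hA4 t) (τ' (κ t))
    rw [permMat_mul, mul_permMat] at this
    by_contra hcon
    simp [permMat_apply, hcon] at this
  refine ⟨ρ, κ, hρ, hκ, fun z => ?_⟩
  have hX : ∀ s t', R12 (σ s) t' + countMat g s (κ.symm t') =
      countMat g' (ρ s) t' + R12 s (τ'.symm t') := by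
    intro s t'
    have := congrFun (congrFun hA2 s) t'
    rw [permMat_mul, mul_permMat, permMat_mul, mul_permMat] at this
    exact this
  let p : S × T' → Prop := fun x =>
    SameCycle (Equiv.prodCongr σ' τ' : Equiv.Perm (S' × T')) (ρ x.1, x.2) z
  have hp : ∀ x : S × T', p x ↔ p (Equiv.prodCongr σ τ' x) := by
    rintro ⟨s, t⟩
    change SameCycle _ _ _ ↔ SameCycle _ (ρ (σ s), τ' t) _
    rw [hρ]
    exact (Equiv.Perm.sameCycle_apply_left
      (f := (Equiv.prodCongr σ' τ' : Equiv.Perm (S' × T')))).symm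
  have e1 : ∑ x ∈ Finset.univ.filter p, R12 (σ x.1) x.2 =
      ∑ x ∈ Finset.univ.filter p, R12 x.1 (τ'.symm x.2) := by
    refine Finset.sum_equiv (Equiv.prodCongr σ τ') (fun x => ?_) (fun x _ => ?_)
    · simp only [Finset.mem_filter, Finset.mem_univ, true_and]
      exact hp x
    · simp
  have e2 : ∑ x ∈ Finset.univ.filter p, (R12 (σ x.1) x.2 + countMat g x.1 (κ.symm x.2)) =
      ∑ x ∈ Finset.univ.filter p, (countMat g' (ρ x.1) x.2 + R12 x.1 (τ'.symm x.2)) :=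
    Finset.sum_congr rfl fun x _ => hX x.1 x.2
  rw [Finset.sum_add_distrib, Finset.sum_add_distrib, e1, add_comm, Nat.add_right_cancel_iff] at e2
  have e3 : ∑ x ∈ Finset.univ.filter p, countMat g x.1 (κ.symm x.2) =
      Nat.card {n // p ((g n).1, κ (g n).2)} := by
    rw [← sum_card_fiber (fun n => ((g n).1, κ (g n).2)) p]
    refine Finset.sum_congr rfl fun x _ => ?_
    rw [countMat_apply]
    refine Nat.card_congr (Equiv.subtypeEquivRight fun n => ?_)
    simp [Prod.ext_iff, Equiv.eq_symm_apply]
  have e4 : ∑ x ∈ Finset.univ.filter p, countMat g' (ρ x.1) x.2 =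
      Nat.card {n // p (ρ.symm (g' n).1, (g' n).2)} := by
    rw [← sum_card_fiber (fun n => (ρ.symm (g' n).1, (g' n).2)) p]
    refine Finset.sum_congr rfl fun x _ => ?_
    rw [countMat_apply]
    refine Nat.card_congr (Equiv.subtypeEquivRight fun n => ?_)
    simp [Prod.ext_iff, Equiv.symm_apply_eq]
  rw [e3, e4] at e2
  simpa [p] using e2

end layered₂

end SqNatMatrix

/-! ### Bounds for the Gelfand-Kirillov dimension -/

section GKDim
variable {K : Type u} {A : Type v} [Field K] [Ring A] [Algebra K A]

lemma gkDim_le_two_of_linear_growth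
    (h : ∀ W : Submodule K A, W.FG → ∃ C : ℕ, ∀ n : ℕ, 1 ≤ n →
      Module.finrank K ((1 ⊔ W) ^ n : Submodule K A) ≤ C * n) : gkDim K A ≤ 2 := by
  refine iSup_le fun W => ?_
  obtain ⟨C, hC⟩ := h W.1 W.2
  refine Filter.limsup_le_of_le (h := ?_)
  filter_upwards [Filter.eventually_ge_atTop (C + 2)] with n hn
  have hn1 : (1 : ℝ) < n := by exact_mod_cast (by omega : 1 < n)
  suffices H : Real.logb n (Module.finrank K ((1 ⊔ W.1) ^ n : Submodule K A)) ≤ 2 by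
    exact EReal.coe_le_coe_iff.2 H
  rcases Nat.eq_zero_or_pos (Module.finrank K ((1 ⊔ W.1) ^ n : Submodule K A)) with h0 | h0
  · rw [h0]; simp
  · rw [Real.logb_le_iff_le_rpow hn1 (by exact_mod_cast h0)]
    have h1 : Module.finrank K ((1 ⊔ W.1) ^ n : Submodule K A) ≤ n ^ 2 :=
      (hC n (by omega)).trans (by rw [sq]; exact Nat.mul_le_mul_right n (by omega))
    exact_mod_cast h1

lemma three_lt_gkDim_of_quartic_growth {W : Submodule K A} (hW : W.FG)
    (h : ∀ n : ℕ, n ^ 4 ≤ Module.finrank K ((1 ⊔ W) ^ (4 * n) : Submodule K A)) :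
    3 < gkDim K A := by
  have h72 : ((7 / 2 : ℝ) : EReal) ≤ gkDim K A := by
    refine le_trans ?_ (le_iSup (fun W : {W : Submodule K A // W.FG} =>
      Filter.limsup (fun n : ℕ =>
        ((Real.logb n (Module.finrank K ((1 ⊔ W.1) ^ n : Submodule K A)) : ℝ) : EReal))
      Filter.atTop) ⟨W, hW⟩)
    refine Filter.le_limsup_of_frequently_le' ?_
    rw [Filter.frequently_atTop]
    intro m
    refine ⟨4 * (4 ^ 7 + m), by omega, ?_⟩
    rw [EReal.coe_le_coe_iff]
    generalize hn : 4 ^ 7 + m = n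
    have hn1 : 4 ^ 7 ≤ n := by omega
    have hn2 : ((4 : ℝ) ^ 7) ≤ n := by exact_mod_cast hn1
    have hn0 : (1 : ℝ) < ((4 * n : ℕ) : ℝ) := by push_cast; linarith
    have hpos : (0 : ℝ) < n := by linarith
    have h1 : Real.logb (4 * n : ℕ) ((n : ℝ) ^ 4) ≤
        Real.logb (4 * n : ℕ) (Module.finrank K ((1 ⊔ W) ^ (4 * n) : Submodule K A)) :=
      Real.logb_le_logb_of_le hn0 (by positivity) (by exact_mod_cast h n)
    -- `(4 n) ^ 7 ≤ n ^ 8` as soon as `4 ^ 7 ≤ n`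
    have h2 : Real.logb (4 * n : ℕ) (((4 * n : ℕ) : ℝ) ^ 7) ≤
        Real.logb (4 * n : ℕ) (((n : ℝ) ^ 4) ^ 2) := by
      refine Real.logb_le_logb_of_le hn0 (by positivity) ?_
      push_cast
      calc (4 * (n : ℝ)) ^ 7 = 4 ^ 7 * (n : ℝ) ^ 7 := by ring
        _ ≤ (n : ℝ) * (n : ℝ) ^ 7 := by gcongr
        _ = ((n : ℝ) ^ 4) ^ 2 := by ring
    rw [Real.logb_pow, Real.logb_pow, Real.logb_self_eq_one hn0] at h2
    push_cast at h1 h2 ⊢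
    linarith
  refine lt_of_lt_of_le ?_ h72
  have : ((3 : ℝ) : EReal) < ((7 / 2 : ℝ) : EReal) := EReal.coe_lt_coe_iff.2 (by norm_num)
  exact this

/-- If `c'` cancels `c` from the left, and `a' c = 0 = c' a`, then the families `a' c' ^ k` and
`c ^ i a` are orthogonal to each other off the diagonal. -/
lemma mul_pow_mul_pow_mul {c c' a a' : A} (h1 : c' * c * c = c) (h2 : c' * c * a = a)
    (h3 : a' * c = 0) (h4 : c' * a = 0) (k i : ℕ) :
    a' * (c' ^ k * (c ^ i * a)) = if k = i then a' * a else 0 := by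
  have h5 : ∀ i : ℕ, c' * (c ^ (i + 1) * a) = c ^ i * a := by
    intro i
    cases i with
    | zero => rw [pow_one, ← mul_assoc, h2, pow_zero, one_mul]
    | succ i =>
      calc c' * (c ^ (i + 1 + 1) * a) = c' * c * c * (c ^ i * a) := by
            simp only [pow_succ', mul_assoc]
        _ = _ := by rw [h1, pow_succ', mul_assoc]
  induction k generalizing i with
  | zero =>
    cases i with
    | zero => simp
    | succ i => rw [pow_succ', pow_zero, one_mul, mul_assoc c, ← mul_assoc a', h3]; simp
  | succ k ih =>
    cases i with
    | zero => rw [pow_zero, one_mul, pow_succ, mul_assoc, h4]; simp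
    | succ i => rw [pow_succ, mul_assoc, h5, ih]; simp

/-- The elements `p i j = c ^ i a d ^ j b` and their left inverses `q k l = b' d' ^ l a' c' ^ k`
form a system of matrix units `p i j * q k l`, which grows like the fourth power of the degree. -/
lemma three_lt_gkDim_of_two_loops {c c' a a' d d' b b' : A}
    (hc : c' * c * c = c) (hca : c' * c * a = a) (hac : a' * c = 0) (hca' : c' * a = 0)
    (had : a' * a * d = d) (hab : a' * a * b = b)
    (hd : d' * d * d = d) (hdb : d' * d * b = b) (hbd : b' * d = 0) (hdb' : d' * b = 0)
    (hv : b' * b * (b' * b) = b' * b) (h0 : b' * b ≠ 0) : 3 < gkDim K A := by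
  classical
  let W : Submodule K A := Submodule.span K {c, c', a, a', d, d', b, b'}
  have hW : W.FG := ⟨{c, c', a, a', d, d', b, b'}, by simp [W]⟩
  have hone : (1 : Submodule K A) ≤ 1 ⊔ W := le_sup_left
  have hmem : ∀ x ∈ ({c, c', a, a', d, d', b, b'} : Set A), x ∈ 1 ⊔ W := fun x hx =>
    (le_sup_right : W ≤ 1 ⊔ W) (Submodule.subset_span hx)
  refine three_lt_gkDim_of_quartic_growth hW fun n => ?_
  let p : Fin n × Fin n → A := fun x => c ^ (x.1 : ℕ) * (a * (d ^ (x.2 : ℕ) * b))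
  let q : Fin n × Fin n → A := fun x => b' * (d' ^ (x.2 : ℕ) * (a' * c' ^ (x.1 : ℕ)))
  have hw : ∀ j : ℕ, a' * a * (d ^ j * b) = d ^ j * b := by
    intro j
    cases j with
    | zero => simpa using hab
    | succ j => rw [pow_succ', mul_assoc d, ← mul_assoc, had]
  have hqp : ∀ x y, q x * p y = if x = y then b' * b else 0 := by
    rintro ⟨k, l⟩ ⟨i, j⟩
    have e1 := mul_pow_mul_pow_mul hc hca hac hca' k i
    have e2 := mul_pow_mul_pow_mul hd hdb hbd hdb' l j
    have e3 : q (k, l) * p (i, j) =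
        b' * (d' ^ (l : ℕ) * ((a' * (c' ^ (k : ℕ) * (c ^ (i : ℕ) * a))) * (d ^ (j : ℕ) * b))) := by
      simp only [p, q, mul_assoc]
    rw [e3, e1]
    by_cases hki : k = i
    · subst hki
      rw [if_pos rfl, hw, e2]
      simp [Fin.ext_iff]
    · rw [if_neg (fun h => hki (Fin.ext h)), if_neg (fun h => hki (congrArg Prod.fst h))]
      simp
  have hpm : ∀ x, p x ∈ (1 ⊔ W) ^ (2 * n) := by
    rintro ⟨i, j⟩
    have h1 : p (i, j) ∈ (1 ⊔ W) ^ (i : ℕ) * ((1 ⊔ W) * ((1 ⊔ W) ^ (j : ℕ) * (1 ⊔ W))) :=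
      Submodule.mul_mem_mul (Submodule.pow_mem_pow _ (hmem c (by simp)) _)
        (Submodule.mul_mem_mul (hmem a (by simp))
          (Submodule.mul_mem_mul (Submodule.pow_mem_pow _ (hmem d (by simp)) _)
            (hmem b (by simp))))
    rw [← pow_succ, ← pow_succ', ← pow_add] at h1
    exact pow_le_pow_right' hone (by have := i.2; have := j.2; omega) h1
  have hqm : ∀ x, q x ∈ (1 ⊔ W) ^ (2 * n) := by
    rintro ⟨i, j⟩
    have h1 : q (i, j) ∈ (1 ⊔ W) * ((1 ⊔ W) ^ (j : ℕ) * ((1 ⊔ W) * (1 ⊔ W) ^ (i : ℕ))) :=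
      Submodule.mul_mem_mul (hmem b' (by simp))
        (Submodule.mul_mem_mul (Submodule.pow_mem_pow _ (hmem d' (by simp)) _)
          (Submodule.mul_mem_mul (hmem a' (by simp))
            (Submodule.pow_mem_pow _ (hmem c' (by simp)) _)))
    rw [← pow_succ', ← pow_add, ← pow_succ'] at h1
    exact pow_le_pow_right' hone (by have := i.2; have := j.2; omega) h1
  have hpq : ∀ x : (Fin n × Fin n) × (Fin n × Fin n),
      p x.1 * q x.2 ∈ (1 ⊔ W) ^ (4 * n) := by
    intro x
    have := Submodule.mul_mem_mul (hpm x.1) (hqm x.2)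
    rwa [← pow_add, ← add_mul] at this
  have hli : LinearIndependent K (fun x : (Fin n × Fin n) × (Fin n × Fin n) =>
      p x.1 * q x.2) := by
    rw [Fintype.linearIndependent_iff]
    intro r hr x
    have h1 : q x.1 * (∑ y : (Fin n × Fin n) × (Fin n × Fin n), r y • (p y.1 * q y.2)) * p x.2 =
        0 := by
      rw [hr]; simp
    rw [Finset.mul_sum, Finset.sum_mul, Finset.sum_eq_single x] at h1
    · have h2 : q x.1 * (r x • (p x.1 * q x.2)) * p x.2 =
          r x • ((q x.1 * p x.1) * (q x.2 * p x.2)) := by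
        simp only [mul_smul_comm, smul_mul_assoc, mul_assoc]
      rw [h2, hqp, hqp, if_pos rfl, if_pos rfl, hv] at h1
      exact (smul_eq_zero.1 h1).resolve_right h0
    · intro y _ hy
      have h2 : q x.1 * (r y • (p y.1 * q y.2)) * p x.2 =
          r y • ((q x.1 * p y.1) * (q y.2 * p x.2)) := by
        simp only [mul_smul_comm, smul_mul_assoc, mul_assoc]
      rw [h2, hqp, hqp]
      by_cases e1 : x.1 = y.1
      · have e2 : y.2 ≠ x.2 := fun e => hy (Prod.ext e1.symm e)
        simp [e2]
      · simp [e1]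
    · simp
  have hfin : Module.Finite K ((1 ⊔ W) ^ (4 * n) : Submodule K A) := by
    rw [Module.Finite.iff_fg]
    exact Submodule.FG.pow (Submodule.FG.sup ⟨{1}, by
      rw [Submodule.one_eq_span, Finset.coe_singleton]⟩ hW) _
  have hli' : LinearIndependent K (fun x : (Fin n × Fin n) × (Fin n × Fin n) =>
      (⟨p x.1 * q x.2, hpq x⟩ : ((1 ⊔ W) ^ (4 * n) : Submodule K A))) :=
    LinearIndependent.of_comp ((1 ⊔ W) ^ (4 * n) : Submodule K A).subtype hli
  have := hli'.fintype_card_le_finrank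
  simp only [Fintype.card_prod, Fintype.card_fin] at this
  refine le_trans (le_of_eq ?_) this
  ring

end GKDim

/-! ### Vertices, edges and ghost edges of the Leavitt path algebra -/

namespace LeavittPathAlgebra
variable (K : Type v) [Field K] (E : FinGraph.{u})

/-- The class of a vertex in the Leavitt path algebra. -/
noncomputable def vert (a : E.V) : LeavittPathAlgebra K E :=
  RingQuot.mkAlgHom K (LeavittRel K E) (leavittVert K E a)

/-- The class of an edge in the Leavitt path algebra. -/
noncomputable def edge (e : E.Edge) : LeavittPathAlgebra K E :=
  RingQuot.mkAlgHom K (LeavittRel K E) (leavittEdge K E e)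

/-- The class of a ghost edge in the Leavitt path algebra. -/
noncomputable def ghost (e : E.Edge) : LeavittPathAlgebra K E :=
  RingQuot.mkAlgHom K (LeavittRel K E) (leavittGhost K E e)

lemma vert_mul_self (a : E.V) : vert K E a * vert K E a = vert K E a := by
  simpa only [map_mul, vert, edge, ghost] using RingQuot.mkAlgHom_rel K (LeavittRel.vert_idem (K := K) a)

lemma vert_mul_of_ne {a b : E.V} (h : a ≠ b) : vert K E a * vert K E b = 0 := by
  simpa only [map_mul, map_zero, vert, edge, ghost] using
    RingQuot.mkAlgHom_rel K (LeavittRel.vert_orth (K := K) a b h)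

lemma source_mul_edge (e : E.Edge) : vert K E (E.s e) * edge K E e = edge K E e := by
  simpa only [map_mul, vert, edge, ghost] using RingQuot.mkAlgHom_rel K (LeavittRel.source_edge (K := K) e)

lemma edge_mul_range (e : E.Edge) : edge K E e * vert K E (E.r e) = edge K E e := by
  simpa only [map_mul, vert, edge, ghost] using RingQuot.mkAlgHom_rel K (LeavittRel.edge_range (K := K) e)

lemma ghost_mul_source (e : E.Edge) : ghost K E e * vert K E (E.s e) = ghost K E e := by
  simpa only [map_mul, vert, edge, ghost] using RingQuot.mkAlgHom_rel K (LeavittRel.ghost_source (K := K) e)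

lemma range_mul_ghost (e : E.Edge) : vert K E (E.r e) * ghost K E e = ghost K E e := by
  simpa only [map_mul, vert, edge, ghost] using RingQuot.mkAlgHom_rel K (LeavittRel.range_ghost (K := K) e)

lemma ghost_mul_edge (e : E.Edge) : ghost K E e * edge K E e = vert K E (E.r e) := by
  simpa only [map_mul, vert, edge, ghost] using RingQuot.mkAlgHom_rel K (LeavittRel.ghost_edge (K := K) e)

lemma ghost_mul_edge_of_ne {e f : E.Edge} (h : e ≠ f) : ghost K E e * edge K E f = 0 := by
  simpa only [map_mul, map_zero, vert, edge, ghost] using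
    RingQuot.mkAlgHom_rel K (LeavittRel.ghost_edge_orth (K := K) e f h)

open Classical in
lemma vert_eq_sum (a : E.V) (h : ∃ e, E.s e = a) : vert K E a =
    ∑ e ∈ Finset.univ.filter (fun e => E.s e = a), edge K E e * ghost K E e := by
  simpa only [map_mul, map_sum, vert, edge, ghost] using
    RingQuot.mkAlgHom_rel K (LeavittRel.sum_edge_ghost (K := K) a h)

lemma sum_vert : ∑ a : E.V, vert K E a = 1 := by
  simpa only [map_sum, map_one, vert] using RingQuot.mkAlgHom_rel K (LeavittRel.one (K := K) (E := E))

/-- If every vertex emits an edge, a vertex together with a natural number can be encoded by an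
edge that starts there together with a natural number. -/
lemma exists_equiv_edge_prod_nat (hE : ∀ a : E.V, ∃ e : E.Edge, E.s e = a) :
    ∃ Φ : E.V × ℕ ≃ E.Edge × ℕ, ∀ x, E.s (Φ x).1 = x.1 := by
  have hφ : ∀ a : E.V, Nonempty (ℕ ≃ {e : E.Edge // E.s e = a} × ℕ) := by
    intro a
    have : Nonempty {e : E.Edge // E.s e = a} := let ⟨e, he⟩ := hE a; ⟨⟨e, he⟩⟩
    exact nonempty_equiv_of_countable
  let φ := fun a => (hφ a).some
  refine ⟨((Equiv.sigmaEquivProd E.V ℕ).symm.trans (Equiv.sigmaCongrRight φ)).trans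
    { toFun := fun y => (y.2.1.1, y.2.2)
      invFun := fun z => ⟨E.s z.1, ⟨z.1, rfl⟩, z.2⟩
      left_inv := ?_
      right_inv := fun z => rfl }, ?_⟩
  · rintro ⟨a, ⟨e, rfl⟩, n⟩
    rfl
  · rintro ⟨a, n⟩
    exact (φ a n).1.2

open Classical in
/-- The operators on the functions on `E⁰ × ℕ` by which the generators act: `Φ` plays the part of
the bijection that splits an infinite path into its first edge and the rest. -/
noncomputable def genAction {K : Type v} [Field K] {E : FinGraph.{u}}
    (Φ : E.V × ℕ ≃ E.Edge × ℕ) : LeavittGen E → Module.End K (E.V × ℕ → K)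
  | .vert a =>
    { toFun := fun f x => if x.1 = a then f x else 0
      map_add' := fun f g => by ext x; dsimp; split_ifs <;> simp
      map_smul' := fun c f => by ext x; dsimp; split_ifs <;> simp }
  | .edge e =>
    { toFun := fun f x => if (Φ x).1 = e then f (E.r e, (Φ x).2) else 0
      map_add' := fun f g => by ext x; dsimp; split_ifs <;> simp
      map_smul' := fun c f => by ext x; dsimp; split_ifs <;> simp }
  | .ghost e =>
    { toFun := fun f x => if x.1 = E.r e then f (Φ.symm (e, x.2)) else 0
      map_add' := fun f g => by ext x; dsimp; split_ifs <;> simp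
      map_smul' := fun c f => by ext x; dsimp; split_ifs <;> simp }

open Classical in
/-- The Leavitt path algebra of a graph without sinks does not collapse. -/
lemma vert_ne_zero (hE : ∀ a : E.V, ∃ e : E.Edge, E.s e = a) (a : E.V) : vert K E a ≠ 0 := by
  obtain ⟨Φ, hΦ⟩ := exists_equiv_edge_prod_nat E hE
  have hΦ' : ∀ e n, (Φ.symm (e, n)).1 = E.s e := by
    intro e n
    rw [← hΦ, Equiv.apply_symm_apply]
  let L := FreeAlgebra.lift K (genAction (K := K) Φ)
  have hv : ∀ a, L (leavittVert K E a) = genAction Φ (.vert a) := fun a =>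
    FreeAlgebra.lift_ι_apply _ _
  have he : ∀ e, L (leavittEdge K E e) = genAction Φ (.edge e) := fun e =>
    FreeAlgebra.lift_ι_apply _ _
  have hg : ∀ e, L (leavittGhost K E e) = genAction Φ (.ghost e) := fun e =>
    FreeAlgebra.lift_ι_apply _ _
  have hrel : ∀ ⦃x y⦄, LeavittRel K E x y → L x = L y := by
    intro x y hxy
    refine LinearMap.ext fun f => funext fun x => ?_
    induction hxy with
    | vert_idem a => simp +contextual [hv, genAction]
    | vert_orth a b h =>
      simp only [hv, map_mul, map_zero, genAction, Module.End.mul_apply]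
      by_cases h1 : x.1 = a
      · have : x.1 ≠ b := fun h2 => h (h1.symm.trans h2)
        simp [this]
      · simp [h1]
    | source_edge e =>
      simp only [hv, he, map_mul, genAction, Module.End.mul_apply]
      by_cases h1 : (Φ x).1 = e
      · simp [h1, ← hΦ x]
      · simp [h1]
    | edge_range e => simp [hv, he, genAction]
    | ghost_source e => simp [hv, hg, genAction, hΦ']
    | range_ghost e => simp +contextual [hv, hg, genAction]
    | ghost_edge e =>
      simp only [hv, he, hg, map_mul, genAction, Module.End.mul_apply]
      by_cases h1 : x.1 = E.r e
      · simp [← h1]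
      · simp [h1]
    | ghost_edge_orth e f h => simp [he, hg, genAction, h]
    | sum_edge_ghost a h =>
      simp only [hv, he, hg, map_mul, map_sum, LinearMap.sum_apply, Finset.sum_apply,
        Module.End.mul_apply]
      by_cases h1 : x.1 = a
      · rw [Finset.sum_eq_single (Φ x).1]
        · simp [genAction, h1]
        · intro e _ hne
          simp [genAction, hne.symm]
        · intro hn
          simp [hΦ, h1] at hn
      · rw [Finset.sum_eq_zero]
        · simp [genAction, h1]
        · intro e hmem
          have : (Φ x).1 ≠ e := by
            rintro rfl
            simp [hΦ, h1] at hmem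
          simp [genAction, this]
    | one =>
      simp only [hv, map_sum, map_one, LinearMap.sum_apply, Finset.sum_apply]
      simp [genAction]
  intro h0
  have h1 := RingQuot.liftAlgHom_mkAlgHom_apply K L hrel (leavittVert K E a)
  change RingQuot.mkAlgHom K (LeavittRel K E) (leavittVert K E a) = 0 at h0
  rw [h0, map_zero, hv] at h1
  have h2 := congrFun (LinearMap.congr_fun h1 (fun _ => 1)) (a, 0)
  simp [genAction] at h2

/-- A path from `a` to `b` gives an element with a left inverse. -/
lemma exists_of_reaches {a b : E.V} (h : E.Reaches a b) : ∃ x y : LeavittPathAlgebra K E,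
    y * x = vert K E b ∧ vert K E a * x = x := by
  unfold FinGraph.Reaches at h
  induction h using Relation.ReflTransGen.head_induction_on with
  | refl => exact ⟨vert K E b, vert K E b, vert_mul_self K E b, vert_mul_self K E b⟩
  | head hstep _ ih =>
    obtain ⟨e, rfl, rfl⟩ := hstep
    obtain ⟨x, y, h1, h2⟩ := ih
    refine ⟨edge K E e * x, y * ghost K E e, ?_, ?_⟩
    · rw [mul_assoc, ← mul_assoc (ghost K E e), ghost_mul_edge, h2, h1]
    · rw [← mul_assoc, source_mul_edge]

end LeavittPathAlgebra

namespace FinGraph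

/-- An edge that lies on a closed path. -/
def IsCyclic (E : FinGraph.{u}) (e : E.Edge) : Prop := E.Reaches (E.r e) (E.s e)

/-- The combinatorial content of the upper bound `3` for the Gelfand-Kirillov dimension: a closed
path with an exit never leads to a closed path with an exit. -/
def NoDoubleExit (E : FinGraph.{u}) : Prop :=
  ∀ g f h k : E.Edge, E.s g = E.s f → g ≠ f → E.IsCyclic g → E.Reaches (E.r f) (E.s h) →
    E.s h = E.s k → h ≠ k → ¬ E.IsCyclic h

open LeavittPathAlgebra in
lemma IsGKThree.noDoubleExit {K : Type v} [Field K] {E : FinGraph.{u}} (hE : E.IsGKThree K) :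
    E.NoDoubleExit := by
  intro g f h k hgf hne hg hfh hhk hne' hh
  -- `c` is a closed path that starts with `g`, `a` a path that starts with `f` and ends where the
  -- closed path `d` with first edge `h` starts, and `b` is the edge `k`
  obtain ⟨x1, y1, e1, i1⟩ := exists_of_reaches K E hg
  obtain ⟨x2, y2, e2, i2⟩ := exists_of_reaches K E hfh
  obtain ⟨x3, y3, e3, i3⟩ := exists_of_reaches K E hh
  have key : ∀ (e e' : E.Edge) (x y : LeavittPathAlgebra K E),
      y * ghost K E e * (edge K E e' * x) = y * ((ghost K E e * edge K E e') * x) := by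
    intros; simp only [mul_assoc]
  have hlt : 3 < gkDim K (LeavittPathAlgebra K E) := by
    refine three_lt_gkDim_of_two_loops (c := edge K E g * x1) (c' := y1 * ghost K E g)
      (a := edge K E f * x2) (a' := y2 * ghost K E f)
      (d := edge K E h * x3) (d' := y3 * ghost K E h)
      (b := edge K E k) (b' := ghost K E k) ?_ ?_ ?_ ?_ ?_ ?_ ?_ ?_ ?_ ?_ ?_ ?_
    · rw [key, ghost_mul_edge, i1, e1, ← mul_assoc, source_mul_edge]
    · rw [key, ghost_mul_edge, i1, e1, hgf, ← mul_assoc, source_mul_edge]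
    · rw [key, ghost_mul_edge_of_ne K E hne.symm]
      · simp
    · rw [key, ghost_mul_edge_of_ne K E hne]
      · simp
    · rw [key, ghost_mul_edge, i2, e2, ← mul_assoc, source_mul_edge]
    · rw [key, ghost_mul_edge, i2, e2, hhk, source_mul_edge]
    · rw [key, ghost_mul_edge, i3, e3, ← mul_assoc, source_mul_edge]
    · rw [key, ghost_mul_edge, i3, e3, hhk, source_mul_edge]
    · rw [← mul_assoc, ghost_mul_edge_of_ne K E hne'.symm, zero_mul]
    · rw [mul_assoc, ghost_mul_edge_of_ne K E hne', mul_zero]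
    · rw [ghost_mul_edge, vert_mul_self]
    · rw [ghost_mul_edge]
      exact vert_ne_zero K E hE.2.1.1 _
  exact hlt.ne' hE.2.2

end FinGraph

/-! ### The Leavitt path algebra of a single cycle -/

namespace LeavittPathAlgebra
variable (K : Type v) [Field K] {E : FinGraph.{u}}

/-- If every vertex emits exactly one edge and receives exactly one edge, the sum of all edges is
a unit, whose inverse is the sum of all ghost edges. -/
noncomputable def sumEdges (hs : Function.Bijective E.s) (hr : Function.Bijective E.r) :
    (LeavittPathAlgebra K E)ˣ where
  val := ∑ e, edge K E e
  inv := ∑ e, ghost K E e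
  val_inv := by
    classical
    rw [Finset.sum_mul_sum, ← sum_vert, ← hs.sum_comp]
    refine Finset.sum_congr rfl fun e _ => ?_
    rw [Finset.sum_eq_single e]
    · rw [vert_eq_sum K E _ ⟨e, rfl⟩]
      have : (Finset.univ.filter fun f => E.s f = E.s e) = {e} := by
        ext f
        simp [hs.1.eq_iff]
      rw [this, Finset.sum_singleton]
    · intro f _ hf
      rw [← edge_mul_range, ← range_mul_ghost, mul_assoc, ← mul_assoc (vert K E (E.r e)),
        vert_mul_of_ne K E (hr.1.ne hf.symm), zero_mul, mul_zero]
    · simp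
  inv_val := by
    classical
    rw [Finset.sum_mul_sum, ← sum_vert, ← hr.sum_comp]
    refine Finset.sum_congr rfl fun e _ => ?_
    rw [Finset.sum_eq_single e]
    · exact ghost_mul_edge K E e
    · intro f _ hf
      exact ghost_mul_edge_of_ne K E hf.symm
    · simp

variable (hs : Function.Bijective E.s) (hr : Function.Bijective E.r)

lemma source_mul_sumEdges (e : E.Edge) :
    vert K E (E.s e) * (sumEdges K hs hr : LeavittPathAlgebra K E) = edge K E e := by
  change vert K E (E.s e) * ∑ f, edge K E f = _
  rw [Finset.mul_sum, Finset.sum_eq_single e, source_mul_edge]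
  · intro f _ hf
    rw [← source_mul_edge, ← mul_assoc, vert_mul_of_ne K E (hs.1.ne hf.symm), zero_mul]
  · simp

lemma sumEdges_mul_range (e : E.Edge) :
    (sumEdges K hs hr : LeavittPathAlgebra K E) * vert K E (E.r e) = edge K E e := by
  change (∑ f, edge K E f) * vert K E (E.r e) = _
  rw [Finset.sum_mul, Finset.sum_eq_single e, edge_mul_range]
  · intro f _ hf
    rw [← edge_mul_range, mul_assoc, vert_mul_of_ne K E (hr.1.ne hf), mul_zero]
  · simp

lemma range_mul_sumEdges_inv (e : E.Edge) :
    vert K E (E.r e) * (↑(sumEdges K hs hr)⁻¹ : LeavittPathAlgebra K E) = ghost K E e := by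
  change vert K E (E.r e) * ∑ f, ghost K E f = _
  rw [Finset.mul_sum, Finset.sum_eq_single e, range_mul_ghost]
  · intro f _ hf
    rw [← range_mul_ghost, ← mul_assoc, vert_mul_of_ne K E (hr.1.ne hf.symm), zero_mul]
  · simp

lemma sumEdges_inv_mul_source (e : E.Edge) :
    (↑(sumEdges K hs hr)⁻¹ : LeavittPathAlgebra K E) * vert K E (E.s e) = ghost K E e := by
  change (∑ f, ghost K E f) * vert K E (E.s e) = _
  rw [Finset.sum_mul, Finset.sum_eq_single e, ghost_mul_source]
  · intro f _ hf
    rw [← ghost_mul_source, mul_assoc, vert_mul_of_ne K E (hs.1.ne hf), mul_zero]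
  · simp

lemma exists_zpow_mul_vert (k : ℤ) (a : E.V) : ∃ b : E.V,
    (↑(sumEdges K hs hr ^ k) : LeavittPathAlgebra K E) * vert K E a =
      vert K E b * ↑(sumEdges K hs hr ^ k) := by
  induction k using Int.induction_on generalizing a with
  | zero => exact ⟨a, by simp⟩
  | succ k ih =>
    obtain ⟨e, rfl⟩ := hr.2 a
    obtain ⟨b, hb⟩ := ih (E.s e)
    refine ⟨b, ?_⟩
    rw [zpow_add_one, Units.val_mul, mul_assoc, sumEdges_mul_range,
      ← source_mul_sumEdges K hs hr e, ← mul_assoc, hb, mul_assoc]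
  | pred k ih =>
    obtain ⟨e, rfl⟩ := hs.2 a
    obtain ⟨b, hb⟩ := ih (E.r e)
    refine ⟨b, ?_⟩
    rw [zpow_sub_one, Units.val_mul, mul_assoc, sumEdges_inv_mul_source,
      ← range_mul_sumEdges_inv K hs hr e, ← mul_assoc, hb, mul_assoc]

/-- The span of the elements `a T ^ k` with a vertex `a` and `|k| ≤ n`, where `T` is the sum of
all edges. -/
noncomputable def laurentSpan (n : ℕ) : Submodule K (LeavittPathAlgebra K E) :=
  Submodule.span K ((fun x : E.V × ℤ => vert K E x.1 * ↑(sumEdges K hs hr ^ x.2)) ''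
    (Finset.univ ×ˢ Finset.Icc (-n : ℤ) n : Finset (E.V × ℤ)))

variable {K hs hr}

lemma vert_mul_zpow_mem_laurentSpan (n : ℕ) (a : E.V) (k : ℤ) (h : -n ≤ k ∧ k ≤ n) :
    vert K E a * ↑(sumEdges K hs hr ^ k) ∈ laurentSpan K hs hr n :=
  Submodule.subset_span ⟨(a, k), by simp [h], rfl⟩

lemma laurentSpan_mono {m n : ℕ} (h : m ≤ n) : laurentSpan K hs hr m ≤ laurentSpan K hs hr n := by
  refine Submodule.span_le.2 ?_
  rintro _ ⟨⟨a, k⟩, hk, rfl⟩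
  simp only [Finset.coe_product, Finset.coe_univ, Finset.coe_Icc, Set.mem_prod, Set.mem_univ,
    Set.mem_Icc, true_and] at hk
  exact vert_mul_zpow_mem_laurentSpan n a k (by omega)

lemma laurentSpan_mul_le (m n : ℕ) :
    laurentSpan K hs hr m * laurentSpan K hs hr n ≤ laurentSpan K hs hr (m + n) := by
  rw [laurentSpan, laurentSpan, Submodule.span_mul_span, Submodule.span_le]
  rintro _ ⟨_, ⟨⟨a, k⟩, hk, rfl⟩, _, ⟨⟨b, l⟩, hl, rfl⟩, rfl⟩
  simp only [Finset.coe_product, Finset.coe_univ, Finset.coe_Icc, Set.mem_prod, Set.mem_univ,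
    Set.mem_Icc, true_and] at hk hl
  obtain ⟨c, hc⟩ := exists_zpow_mul_vert K hs hr k b
  have e : vert K E a * ↑(sumEdges K hs hr ^ k) * (vert K E b * ↑(sumEdges K hs hr ^ l)) =
      vert K E a * vert K E c * ↑(sumEdges K hs hr ^ (k + l)) := by
    rw [mul_assoc, ← mul_assoc _ (vert K E b), hc, zpow_add, Units.val_mul]
    simp only [mul_assoc]
  change vert K E a * ↑(sumEdges K hs hr ^ k) * (vert K E b * ↑(sumEdges K hs hr ^ l)) ∈
    laurentSpan K hs hr (m + n)
  rw [e]
  by_cases hac : a = c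
  · subst hac
    rw [vert_mul_self]
    exact vert_mul_zpow_mem_laurentSpan _ _ _ (by push_cast; omega)
  · rw [vert_mul_of_ne K E hac, zero_mul]
    exact zero_mem _

lemma one_mem_laurentSpan : 1 ∈ laurentSpan K hs hr 0 := by
  rw [← sum_vert K E]
  refine Submodule.sum_mem _ fun a _ => ?_
  simpa using vert_mul_zpow_mem_laurentSpan (K := K) (hs := hs) (hr := hr) 0 a 0 (by simp)

lemma exists_mem_laurentSpan (x : LeavittPathAlgebra K E) : ∃ n, x ∈ laurentSpan K hs hr n := by
  obtain ⟨y, rfl⟩ := RingQuot.mkAlgHom_surjective K (LeavittRel K E) x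
  induction y using FreeAlgebra.induction with
  | grade0 r =>
    refine ⟨0, ?_⟩
    rw [AlgHom.commutes, Algebra.algebraMap_eq_smul_one]
    exact Submodule.smul_mem _ _ one_mem_laurentSpan
  | grade1 g =>
    refine ⟨1, ?_⟩
    cases g with
    | vert a =>
      change vert K E a ∈ _
      simpa using vert_mul_zpow_mem_laurentSpan (K := K) (hs := hs) (hr := hr) 1 a 0 (by simp)
    | edge e =>
      change edge K E e ∈ _
      rw [← source_mul_sumEdges K hs hr]
      simpa using vert_mul_zpow_mem_laurentSpan (K := K) (hs := hs) (hr := hr) 1 (E.s e) 1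
        (by simp)
    | ghost e =>
      change ghost K E e ∈ _
      rw [← range_mul_sumEdges_inv K hs hr]
      simpa using vert_mul_zpow_mem_laurentSpan (K := K) (hs := hs) (hr := hr) 1 (E.r e) (-1)
        (by simp)
  | mul a b ha hb =>
    obtain ⟨m, hm⟩ := ha
    obtain ⟨n, hn⟩ := hb
    refine ⟨m + n, ?_⟩
    rw [map_mul]
    exact laurentSpan_mul_le m n (Submodule.mul_mem_mul hm hn)
  | add a b ha hb =>
    obtain ⟨m, hm⟩ := ha
    obtain ⟨n, hn⟩ := hb
    refine ⟨m + n, ?_⟩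
    rw [map_add]
    exact add_mem (laurentSpan_mono (Nat.le_add_right m n) hm)
      (laurentSpan_mono (Nat.le_add_left n m) hn)

lemma finrank_laurentSpan_le (n : ℕ) :
    Module.finrank K (laurentSpan K hs hr n) ≤ Fintype.card E.V * (2 * n + 1) := by
  classical
  rw [laurentSpan, ← Finset.coe_image]
  refine (finrank_span_finset_le_card _).trans (Finset.card_image_le.trans ?_)
  rw [Finset.card_product, Finset.card_univ, Int.card_Icc]
  exact Nat.mul_le_mul_left _ (by omega)

lemma gkDim_le_two (hs : Function.Bijective E.s) (hr : Function.Bijective E.r) :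
    gkDim K (LeavittPathAlgebra K E) ≤ 2 := by
  refine gkDim_le_two_of_linear_growth fun W hW => ?_
  obtain ⟨m, hm⟩ : ∃ m, 1 ⊔ W ≤ laurentSpan K hs hr m := by
    obtain ⟨t, rfl⟩ := hW
    choose f hf using exists_mem_laurentSpan (K := K) (hs := hs) (hr := hr)
    refine ⟨t.sup f, sup_le ?_ (Submodule.span_le.2 fun x hx =>
      laurentSpan_mono (Finset.le_sup hx) (hf x))⟩
    rw [Submodule.one_le]
    exact laurentSpan_mono (Nat.zero_le _) one_mem_laurentSpan
  have hpow : ∀ n : ℕ, (1 ⊔ W) ^ n ≤ laurentSpan K hs hr (m * n) := by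
    intro n
    induction n with
    | zero =>
      rw [pow_zero, Submodule.one_le]
      exact one_mem_laurentSpan
    | succ n ih =>
      rw [pow_succ, mul_add, mul_one]
      exact (mul_le_mul' ih hm).trans (laurentSpan_mul_le _ _)
  refine ⟨Fintype.card E.V * (2 * m + 1), fun n hn => ?_⟩
  have hfin : Module.Finite K (laurentSpan K hs hr (m * n)) :=
    Module.Finite.span_of_finite K (Set.toFinite _)
  refine (Submodule.finrank_mono (hpow n)).trans ((finrank_laurentSpan_le _).trans ?_)
  rw [mul_assoc]
  refine Nat.mul_le_mul_left _ ?_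
  rw [add_mul, one_mul, mul_assoc]
  omega

end LeavittPathAlgebra

/-! ### Cycles in graphs without double exits -/

lemma exists_reflTransGen_transGen {α : Type*} [Finite α] {R : α → α → Prop}
    (h : ∀ a, ∃ b, R a b) (a : α) : ∃ b, Relation.ReflTransGen R a b ∧ Relation.TransGen R b b := by
  choose f hf using h
  have hpath : ∀ (n : ℕ) b, Relation.ReflTransGen R b (f^[n] b) := by
    intro n b
    induction n with
    | zero => exact .refl
    | succ n ih => rw [Function.iterate_succ_apply']; exact ih.tail (hf _)
  obtain ⟨i, j, hij, he⟩ := Finite.exists_ne_map_eq_of_infinite (fun n : ℕ => f^[n] a)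
  wlog hlt : i < j generalizing i j
  · exact this j i hij.symm he.symm (by omega)
  refine ⟨f^[i] a, hpath i a, ?_⟩
  obtain ⟨k, rfl⟩ : ∃ k, j = k + 1 + i := ⟨j - i - 1, by omega⟩
  have he : f^[i] a = f^[k + 1 + i] a := he
  rw [Function.iterate_add_apply, Function.iterate_succ_apply] at he
  have h1 := Relation.TransGen.head' (hf (f^[i] a)) (hpath k (f (f^[i] a)))
  rwa [← he] at h1

namespace FinGraph
variable {E : FinGraph.{u}}

lemma reaches_edge (e : E.Edge) : E.Reaches (E.s e) (E.r e) :=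
  Relation.ReflTransGen.single ⟨e, rfl, rfl⟩

lemma Reaches.trans {a b c : E.V} (h : E.Reaches a b) (h' : E.Reaches b c) : E.Reaches a c :=
  Relation.ReflTransGen.trans h h'

/-- The vertex lies on a closed path. -/
def OnClosedPath (E : FinGraph.{u}) (a : E.V) : Prop := ∃ e, E.IsCyclic e ∧ E.s e = a

lemma IsCyclic.onClosedPath {e : E.Edge} (h : E.IsCyclic e) : E.OnClosedPath (E.s e) := ⟨e, h, rfl⟩

lemma onClosedPath_of_transGen {a : E.V} (h : Relation.TransGen E.Step a a) :
    E.OnClosedPath a := by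
  obtain ⟨b, ⟨e, rfl, rfl⟩, h2⟩ := Relation.TransGen.head'_iff.1 h
  exact ⟨e, h2, rfl⟩

lemma OnClosedPath.exists_range {a : E.V} (h : E.OnClosedPath a) :
    ∃ e, E.IsCyclic e ∧ E.r e = a := by
  obtain ⟨e, he, rfl⟩ := h
  rcases Relation.ReflTransGen.cases_tail he with h1 | ⟨c, h1, f, rfl, h3⟩
  · exact ⟨e, he, h1.symm⟩
  · refine ⟨f, ?_, h3⟩
    unfold IsCyclic
    rw [h3]
    exact (reaches_edge e).trans h1

lemma IsCyclic.onClosedPath_range {e : E.Edge} (h : E.IsCyclic e) : E.OnClosedPath (E.r e) := by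
  refine onClosedPath_of_transGen ?_
  exact Relation.TransGen.tail' h ⟨e, rfl, rfl⟩

lemma Essential.exists_reaches_onClosedPath (hE : E.Essential) (a : E.V) :
    ∃ b, E.Reaches a b ∧ E.OnClosedPath b := by
  obtain ⟨b, h1, h2⟩ := exists_reflTransGen_transGen (R := E.Step)
    (fun a => let ⟨e, he⟩ := hE.1 a; ⟨E.r e, e, he, rfl⟩) a
  exact ⟨b, h1, onClosedPath_of_transGen h2⟩

lemma Essential.exists_onClosedPath_reaches (hE : E.Essential) (a : E.V) :
    ∃ b, E.Reaches b a ∧ E.OnClosedPath b := by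
  obtain ⟨b, h1, h2⟩ := exists_reflTransGen_transGen (R := Function.swap E.Step)
    (fun a => let ⟨e, he⟩ := hE.2 a; ⟨E.s e, e, rfl, he⟩) a
  exact ⟨b, Relation.reflTransGen_swap.1 h1, onClosedPath_of_transGen (Relation.transGen_swap.1 h2)⟩

lemma NoDoubleExit.eq_of_isCyclic (hN : E.NoDoubleExit) {e f : E.Edge} (he : E.IsCyclic e)
    (hf : E.IsCyclic f) (h : E.s e = E.s f) : e = f := by
  by_contra hne
  exact hN e f e f h hne he (h ▸ hf) h hne he

open Classical in
/-- An edge that starts at `a`, cyclic if possible. -/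
noncomputable def outEdge (hE : E.Essential) (a : E.V) : E.Edge :=
  if h : E.OnClosedPath a then h.choose else (hE.1 a).choose

lemma s_outEdge (hE : E.Essential) (a : E.V) : E.s (outEdge hE a) = a := by
  unfold outEdge
  split_ifs with h
  · exact h.choose_spec.2
  · exact (hE.1 a).choose_spec

lemma isCyclic_outEdge (hE : E.Essential) {a : E.V} (h : E.OnClosedPath a) :
    E.IsCyclic (outEdge hE a) := by
  unfold outEdge
  rw [dif_pos h]
  exact h.choose_spec.1

lemma IsCyclic.eq_outEdge {e : E.Edge} (he : E.IsCyclic e) (hE : E.Essential)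
    (hN : E.NoDoubleExit) : outEdge hE (E.s e) = e :=
  hN.eq_of_isCyclic (isCyclic_outEdge hE he.onClosedPath) he (s_outEdge hE _)

open Classical in
/-- The permutation of the vertices that moves every vertex on a closed path one step along its
cycle and fixes the other vertices. -/
noncomputable def next (hE : E.Essential) (hN : E.NoDoubleExit) : Equiv.Perm E.V :=
  Equiv.ofBijective (fun a => if E.OnClosedPath a then E.r (outEdge hE a) else a)
    (Finite.surjective_iff_bijective.1 fun a => by
      by_cases h : E.OnClosedPath a
      · obtain ⟨e, he, rfl⟩ := h.exists_range
        exact ⟨E.s e, by rw [if_pos he.onClosedPath, he.eq_outEdge hE hN]⟩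
      · exact ⟨a, if_neg h⟩)

section
variable (hE : E.Essential) (hN : E.NoDoubleExit)

lemma next_apply {a : E.V} (h : E.OnClosedPath a) : next hE hN a = E.r (outEdge hE a) :=
  if_pos h

lemma next_source {e : E.Edge} (h : E.IsCyclic e) : next hE hN (E.s e) = E.r e := by
  rw [next_apply hE hN h.onClosedPath, h.eq_outEdge hE hN]

lemma onClosedPath_next_iterate {a : E.V} (h : E.OnClosedPath a) (n : ℕ) :
    E.OnClosedPath ((next hE hN)^[n] a) := by
  induction n with
  | zero => exact h
  | succ n ih =>
    rw [Function.iterate_succ_apply', next_apply hE hN ih]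
    exact (isCyclic_outEdge hE ih).onClosedPath_range

/-- The cycle through a vertex on a closed path, indexed so that this vertex has index `0`. -/
noncomputable def cycleAt (a : E.V) (h : E.OnClosedPath a) : E.Cycle where
  len := Function.minimalPeriod (next hE hN) a
  len_pos := Function.minimalPeriod_pos_of_mem_periodicPts
    ((next hE hN).injective.mem_periodicPts a)
  edge k := outEdge hE ((next hE hN)^[k.val] a)
  chain k := by
    have : NeZero (Function.minimalPeriod (next hE hN) a) :=
      ⟨(Function.minimalPeriod_pos_of_mem_periodicPts
        ((next hE hN).injective.mem_periodicPts a)).ne'⟩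
    rw [s_outEdge, ← next_apply hE hN (onClosedPath_next_iterate hE hN h _),
      ← Function.iterate_succ_apply' (next hE hN), ZMod.val_add, ZMod.val_one_eq_one_mod, Nat.add_mod_mod,
      Function.iterate_mod_minimalPeriod_eq]
  distinct := by
    have : NeZero (Function.minimalPeriod (next hE hN) a) :=
      ⟨(Function.minimalPeriod_pos_of_mem_periodicPts
        ((next hE hN).injective.mem_periodicPts a)).ne'⟩
    intro k l hkl
    simp only [s_outEdge] at hkl
    exact ZMod.val_injective _ (Function.iterate_injOn_Iio_minimalPeriod (ZMod.val_lt k)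
      (ZMod.val_lt l) hkl)

lemma cycleAt_vertex_zero (a : E.V) (h : E.OnClosedPath a) :
    (cycleAt hE hN a h).vertex 0 = a := by
  have h0 : (0 : ZMod (Function.minimalPeriod (next hE hN) a)).val = 0 := ZMod.val_zero
  refine (s_outEdge hE _).trans ?_
  exact congrArg (fun n => (next hE hN)^[n] a) h0

lemma mem_cycleAt_verts (a : E.V) (h : E.OnClosedPath a) : a ∈ (cycleAt hE hN a h).verts :=
  ⟨0, cycleAt_vertex_zero hE hN a h⟩

end

namespace Cycle

instance (C : E.Cycle) : NeZero C.len := ⟨C.len_pos.ne'⟩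

lemma vertex_injective (C : E.Cycle) : Function.Injective C.vertex := C.distinct

lemma r_edge (C : E.Cycle) (k : ZMod C.len) : E.r (C.edge k) = C.vertex (k + 1) := C.chain k

lemma vertex_mem (C : E.Cycle) (k : ZMod C.len) : C.vertex k ∈ C.verts := ⟨k, rfl⟩

lemma reaches (C : E.Cycle) (k l : ZMod C.len) : E.Reaches (C.vertex k) (C.vertex l) := by
  have h : ∀ n : ℕ, E.Reaches (C.vertex k) (C.vertex (k + n)) := by
    intro n
    induction n with
    | zero =>
      rw [Nat.cast_zero, add_zero]
      exact Relation.ReflTransGen.refl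
    | succ n ih =>
      refine ih.trans ?_
      push_cast
      rw [← add_assoc, ← r_edge]
      exact reaches_edge _
  have := h (l - k).val
  rwa [ZMod.natCast_zmod_val, add_sub_cancel] at this

lemma reaches_of_mem (C : E.Cycle) {a b : E.V} (ha : a ∈ C.verts) (hb : b ∈ C.verts) :
    E.Reaches a b := by
  obtain ⟨k, rfl⟩ := ha
  obtain ⟨l, rfl⟩ := hb
  exact C.reaches k l

lemma isCyclic_edge (C : E.Cycle) (k : ZMod C.len) : E.IsCyclic (C.edge k) := by
  unfold IsCyclic
  rw [r_edge]
  exact C.reaches _ _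

lemma onClosedPath (C : E.Cycle) {a : E.V} (ha : a ∈ C.verts) : E.OnClosedPath a := by
  obtain ⟨k, rfl⟩ := ha
  exact ⟨C.edge k, C.isCyclic_edge k, rfl⟩

end Cycle

section
variable (hE : E.Essential) (hN : E.NoDoubleExit)
include hE hN

lemma Cycle.next_vertex (C : E.Cycle) (k : ZMod C.len) :
    next hE hN (C.vertex k) = C.vertex (k + 1) := by
  rw [← C.r_edge]
  exact next_source hE hN (C.isCyclic_edge k)

lemma Cycle.next_zpow_vertex (C : E.Cycle) (k : ZMod C.len) (n : ℤ) :
    (next hE hN ^ n) (C.vertex k) = C.vertex (k + n) := by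
  induction n using Int.induction_on generalizing k with
  | zero => simp
  | succ n ih =>
    rw [zpow_add_one, Equiv.Perm.mul_apply, C.next_vertex hE hN, ih]
    push_cast
    congr 1
    ring
  | pred n ih =>
    rw [zpow_sub_one, Equiv.Perm.mul_apply, Equiv.Perm.inv_eq_iff_eq.2
      (show C.vertex k = next hE hN (C.vertex (k - 1)) by rw [C.next_vertex hE hN]; simp), ih]
    push_cast
    congr 1
    ring

lemma Cycle.r_mem_verts (C : E.Cycle) {e : E.Edge} (he : E.IsCyclic e) (h : E.s e ∈ C.verts) :
    E.r e ∈ C.verts := by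
  obtain ⟨k, hk⟩ := h
  rw [← next_source hE hN he, ← hk, C.next_vertex hE hN]
  exact C.vertex_mem _

lemma Cycle.mem_verts_of_reaches (C : E.Cycle) {a b : E.V} (ha : a ∈ C.verts)
    (hab : E.Reaches a b) (hba : E.Reaches b a) : b ∈ C.verts := by
  unfold Reaches at hab
  induction hab with
  | refl => exact ha
  | tail h1 hstep ih =>
    obtain ⟨e, rfl, rfl⟩ := hstep
    exact C.r_mem_verts hE hN (hba.trans h1) (ih ((reaches_edge e).trans hba))

lemma Cycle.s_mem_verts (C : E.Cycle) {e : E.Edge} (he : E.IsCyclic e) (h : E.r e ∈ C.verts) :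
    E.s e ∈ C.verts :=
  C.mem_verts_of_reaches hE hN h he (reaches_edge e)

lemma Cycle.verts_eq (C D : E.Cycle) {a : E.V} (hC : a ∈ C.verts) (hD : a ∈ D.verts) :
    C.verts = D.verts := by
  ext b
  exact ⟨fun h => D.mem_verts_of_reaches hE hN hD (C.reaches_of_mem hC h) (C.reaches_of_mem h hC),
    fun h => C.mem_verts_of_reaches hE hN hC (D.reaches_of_mem hD h) (D.reaches_of_mem h hD)⟩

lemma Cycle.range_edge (C : E.Cycle) : Set.range C.edge = outEdge hE '' C.verts := by
  ext e
  constructor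
  · rintro ⟨k, rfl⟩
    exact ⟨C.vertex k, C.vertex_mem k, (C.isCyclic_edge k).eq_outEdge hE hN⟩
  · rintro ⟨_, ⟨k, rfl⟩, rfl⟩
    exact ⟨k, ((C.isCyclic_edge k).eq_outEdge hE hN).symm⟩

lemma Cycle.same_of_mem (C D : E.Cycle) {a : E.V} (hC : a ∈ C.verts) (hD : a ∈ D.verts) :
    C.Same D := by
  unfold Cycle.Same
  rw [C.range_edge hE hN, D.range_edge hE hN, C.verts_eq hE hN D hC hD]

omit hE hN in
lemma Cycle.verts_eq_image (C : E.Cycle) : C.verts = E.s '' Set.range C.edge := by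
  rw [← Set.range_comp]
  rfl

omit hE hN in
lemma Cycle.Same.verts_eq {C D : E.Cycle} (h : C.Same D) : C.verts = D.verts := by
  rw [C.verts_eq_image, D.verts_eq_image, show Set.range C.edge = _ from h]

lemma Cycle.exists_exit (C : E.Cycle) {a b : E.V} (hab : E.Reaches a b) (ha : a ∈ C.verts)
    (hb : b ∉ C.verts) : ∃ g, E.s g ∈ C.verts ∧ ¬ E.IsCyclic g ∧ E.Reaches (E.r g) b := by
  unfold Reaches at hab
  induction hab using Relation.ReflTransGen.head_induction_on with
  | refl => exact absurd ha hb
  | head hstep h1 ih =>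
    obtain ⟨e, rfl, rfl⟩ := hstep
    by_cases he : E.IsCyclic e
    · exact ih (C.r_mem_verts hE hN he ha)
    · exact ⟨e, ha, he, h1⟩

lemma Cycle.exists_entry (C : E.Cycle) {a b : E.V} (hab : E.Reaches a b) (hb : b ∈ C.verts)
    (ha : a ∉ C.verts) : ∃ g, E.r g ∈ C.verts ∧ ¬ E.IsCyclic g ∧ E.Reaches a (E.s g) := by
  unfold Reaches at hab
  induction hab with
  | refl => exact absurd hb ha
  | tail h1 hstep ih =>
    obtain ⟨e, rfl, rfl⟩ := hstep
    by_cases he : E.IsCyclic e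
    · exact ih (C.s_mem_verts hE hN he hb)
    · exact ⟨e, hb, he, h1⟩

lemma Cycle.leadsTo_of_reaches (C D : E.Cycle) {a b : E.V} (ha : a ∈ C.verts) (hb : b ∈ D.verts)
    (hab : E.Reaches a b) (hb' : b ∉ C.verts) : C.LeadsTo D := by
  refine ⟨Set.disjoint_left.2 fun c hc hd => hb' ?_, a, ha, b, hb, hab⟩
  rwa [C.verts_eq hE hN D hc hd]

/-- A cycle is a source cycle if and only if it has an exit. -/
lemma Cycle.isSource_iff (C : E.Cycle) :
    C.IsSource ↔ ∃ f, E.s f ∈ C.verts ∧ ¬ E.IsCyclic f := by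
  constructor
  · rintro ⟨D, hd, a, ha, b, hb, hab⟩
    obtain ⟨g, h1, h2, _⟩ := C.exists_exit hE hN hab ha (Set.disjoint_right.1 hd hb)
    exact ⟨g, h1, h2⟩
  · rintro ⟨f, hf, hcf⟩
    obtain ⟨b, hb, hcb⟩ := hE.exists_reaches_onClosedPath (E.r f)
    refine ⟨cycleAt hE hN b hcb, C.leadsTo_of_reaches hE hN _ hf (mem_cycleAt_verts hE hN b hcb)
      ((reaches_edge f).trans hb) fun hbC => hcf ?_⟩
    exact hb.trans (C.reaches_of_mem hbC hf)

/-- A cycle is a sink cycle if and only if it is entered from outside. -/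
lemma Cycle.isSink_iff (C : E.Cycle) :
    C.IsSink ↔ ∃ f, E.r f ∈ C.verts ∧ ¬ E.IsCyclic f := by
  constructor
  · rintro ⟨D, hd, a, ha, b, hb, hab⟩
    obtain ⟨g, h1, h2, _⟩ := C.exists_entry hE hN hab hb (Set.disjoint_left.1 hd ha)
    exact ⟨g, h1, h2⟩
  · rintro ⟨f, hf, hcf⟩
    obtain ⟨b, hb, hcb⟩ := hE.exists_onClosedPath_reaches (E.s f)
    have hbC : b ∉ C.verts := fun hbC => hcf ((C.reaches_of_mem hf hbC).trans hb)
    refine ⟨cycleAt hE hN b hcb, Cycle.leadsTo_of_reaches hE hN _ C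
      (mem_cycleAt_verts hE hN b hcb) hf (hb.trans (reaches_edge f)) fun h => hbC ?_⟩
    rw [← Cycle.verts_eq hE hN _ C h hf]
    exact mem_cycleAt_verts hE hN b hcb

lemma Cycle.not_isSource_of_isSink (C : E.Cycle) (h : C.IsSink) : ¬ C.IsSource := by
  intro h'
  obtain ⟨k, hk, hck⟩ := (C.isSource_iff hE hN).1 h'
  obtain ⟨D, hd, a, ha, b, hb, hab⟩ := h
  obtain ⟨g, h1, h2, h3⟩ := D.exists_exit hE hN hab ha (Set.disjoint_right.1 hd hb)
  have hg := isCyclic_outEdge hE (D.onClosedPath h1)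
  have hk' := isCyclic_outEdge hE (C.onClosedPath hk)
  refine hN (outEdge hE (E.s g)) g (outEdge hE (E.s k)) k (s_outEdge hE _) ?_ hg ?_
    (s_outEdge hE _) ?_ hk'
  · intro e; rw [e] at hg; exact h2 hg
  · rw [s_outEdge]
    exact h3.trans (C.reaches_of_mem hb hk)
  · intro e; rw [e] at hk'; exact hck hk'

lemma onSourceCycle_iff (C : E.Cycle) {a : E.V} (ha : a ∈ C.verts) :
    E.OnSourceCycle a ↔ C.IsSource := by
  constructor
  · rintro ⟨D, hD, haD⟩
    rw [D.isSource_iff hE hN, D.verts_eq hE hN C haD ha] at hD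
    exact (C.isSource_iff hE hN).2 hD
  · exact fun h => ⟨C, h, ha⟩

lemma onSinkCycle_iff (C : E.Cycle) {a : E.V} (ha : a ∈ C.verts) :
    E.OnSinkCycle a ↔ C.IsSink := by
  constructor
  · rintro ⟨D, hD, haD⟩
    rw [D.isSink_iff hE hN, D.verts_eq hE hN C haD ha] at hD
    exact (C.isSink_iff hE hN).2 hD
  · exact fun h => ⟨C, h, ha⟩

end

/-- A cycle without exits and entries is the whole graph, and then the Gelfand-Kirillov dimension
is too small. -/
lemma IsGKThree.isSource_or_isSink {K : Type v} [Field K] (h : E.IsGKThree K) (C : E.Cycle) :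
    C.IsSource ∨ C.IsSink := by
  have hE := h.2.1
  have hN := h.noDoubleExit
  by_contra! hcon
  rw [C.isSource_iff hE hN, C.isSink_iff hE hN] at hcon
  push Not at hcon
  obtain ⟨hout, hin⟩ := hcon
  have hstep : ∀ a b, E.Step a b → (a ∈ C.verts ↔ b ∈ C.verts) := by
    rintro _ _ ⟨e, rfl, rfl⟩
    exact ⟨fun ha => C.r_mem_verts hE hN (hout e ha) ha,
      fun hb => C.s_mem_verts hE hN (hin e hb) hb⟩
  have hall : ∀ a, a ∈ C.verts := by
    intro a
    have hab := h.1.2 (C.vertex 0) a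
    have : ∀ a b, Relation.EqvGen E.Step a b → (a ∈ C.verts ↔ b ∈ C.verts) := by
      intro a b hab
      induction hab with
      | rel _ _ h => exact hstep _ _ h
      | refl _ => exact Iff.rfl
      | symm _ _ _ ih => exact ih.symm
      | trans _ _ _ _ _ ih1 ih2 => exact ih1.trans ih2
    exact (this _ _ hab).1 (C.vertex_mem 0)
  have hs : Function.Bijective E.s :=
    ⟨fun e f hef => hN.eq_of_isCyclic (hout e (hall _)) (hout f (hall _)) hef, hE.1⟩
  have hr : Function.Bijective E.r :=
    (Fintype.bijective_iff_surjective_and_card _).2 ⟨hE.2, Fintype.card_of_bijective hs⟩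
  have h2 := LeavittPathAlgebra.gkDim_le_two (K := K) hs hr
  rw [h.2.2] at h2
  have h3 : ((3 : ℝ) : EReal) ≤ ((2 : ℝ) : EReal) := h2
  rw [EReal.coe_le_coe_iff] at h3
  norm_num at h3

end FinGraph

/-! ### Graphs in normal form consist of two layers of cycles -/

namespace FinGraph
open SqNatMatrix
variable {E : FinGraph.{u}}

lemma exists_path_into {p : E.V → Prop} {a b : E.V} (hab : E.Reaches a b) (ha : p a) (hb : ¬ p b) :
    ∃ (l : List E.Edge) (hl : l ≠ []), l.IsChain (fun e f => E.r e = E.s f) ∧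
      p (E.s (l.head hl)) ∧ E.r (l.getLast hl) = b ∧ ∀ e ∈ l, ¬ p (E.r e) := by
  unfold Reaches at hab
  induction hab with
  | refl => exact absurd ha hb
  | tail _ hstep ih =>
    obtain ⟨e, rfl, rfl⟩ := hstep
    by_cases hp : p (E.s e)
    · exact ⟨[e], by simp, by simp, by simpa using hp, by simp, by simpa using hb⟩
    · obtain ⟨l, hl, h1, h2, h3, h4⟩ := ih hp
      refine ⟨l ++ [e], by simp, ?_, ?_, by simp, ?_⟩
      · rw [List.isChain_append]
        refine ⟨h1, by simp, ?_⟩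
        intro x hx y hy
        rw [List.getLast?_eq_some_getLast hl] at hx
        simp only [Option.mem_def, Option.some.injEq, List.head?_cons] at hx hy
        rw [← hx, ← hy, h3]
      · rwa [List.head_append_of_ne_nil hl]
      · intro f hf
        rcases List.mem_append.1 hf with hf | hf
        · exact h4 f hf
        · rw [List.mem_singleton.1 hf]
          exact hb

lemma exists_path_out {p : E.V → Prop} {a b : E.V} (hab : E.Reaches a b) (ha : ¬ p a) (hb : p b) :
    ∃ (l : List E.Edge) (hl : l ≠ []), l.IsChain (fun e f => E.r e = E.s f) ∧
      E.s (l.head hl) = a ∧ p (E.r (l.getLast hl)) ∧ ¬ p (E.s (l.getLast hl)) ∧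
      ∀ e ∈ l.dropLast, ¬ p (E.r e) := by
  unfold Reaches at hab
  induction hab using Relation.ReflTransGen.head_induction_on with
  | refl => exact absurd hb ha
  | head hstep _ ih =>
    obtain ⟨e, rfl, rfl⟩ := hstep
    by_cases hp : p (E.r e)
    · exact ⟨[e], by simp, by simp, by simp, by simpa using hp, by simpa using ha, by simp⟩
    · obtain ⟨l, hl, h1, h2, h3, h4, h5⟩ := ih hp
      refine ⟨e :: l, by simp, ?_, by simp, ?_, ?_, ?_⟩
      · rw [List.isChain_cons]
        refine ⟨?_, h1⟩
        intro y hy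
        rw [List.head?_eq_some_head hl] at hy
        simp only [Option.mem_def, Option.some.injEq] at hy
        rw [← hy, h2]
      · rwa [List.getLast_cons hl]
      · rwa [List.getLast_cons hl]
      · intro f hf
        rw [List.dropLast_cons_of_ne_nil hl] at hf
        rcases List.mem_cons.1 hf with rfl | hf
        · exact hp
        · exact h5 f hf

lemma OnSourceCycle.onClosedPath {a : E.V} (h : E.OnSourceCycle a) : E.OnClosedPath a :=
  let ⟨C, _, ha⟩ := h
  C.onClosedPath ha

lemma OnSinkCycle.onClosedPath {a : E.V} (h : E.OnSinkCycle a) : E.OnClosedPath a :=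
  let ⟨C, _, ha⟩ := h
  C.onClosedPath ha

lemma onSourceCycle_of_exit (hE : E.Essential) (hN : E.NoDoubleExit) {e : E.Edge}
    (he : ¬ E.IsCyclic e) (h : E.OnClosedPath (E.s e)) : E.OnSourceCycle (E.s e) :=
  ⟨cycleAt hE hN _ h, ((cycleAt hE hN _ h).isSource_iff hE hN).2
    ⟨e, mem_cycleAt_verts hE hN _ h, he⟩, mem_cycleAt_verts hE hN _ h⟩

lemma onSinkCycle_of_entry (hE : E.Essential) (hN : E.NoDoubleExit) {e : E.Edge}
    (he : ¬ E.IsCyclic e) (h : E.OnClosedPath (E.r e)) : E.OnSinkCycle (E.r e) :=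
  ⟨cycleAt hE hN _ h, ((cycleAt hE hN _ h).isSink_iff hE hN).2
    ⟨e, mem_cycleAt_verts hE hN _ h, he⟩, mem_cycleAt_verts hE hN _ h⟩

namespace InNormalForm
variable {K : Type v} [Field K] (h : E.InNormalForm K)
include h

lemma essential : E.Essential := h.1.2.1

lemma noDoubleExit : E.NoDoubleExit := h.1.noDoubleExit

/-- In normal form there is no vertex off the cycles, as it would be an interior vertex of a
trail. -/
lemma onClosedPath (a : E.V) : E.OnClosedPath a := by
  by_contra ha
  have hE := h.essential
  have hN := h.noDoubleExit
  obtain ⟨b, hba, hb⟩ := hE.exists_onClosedPath_reaches a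
  obtain ⟨c, hac, hc⟩ := hE.exists_reaches_onClosedPath a
  obtain ⟨p, hp, p1, p2, p3, p4⟩ := exists_path_into hba hb ha
  obtain ⟨q, hq, q1, q2, q3, q4, q5⟩ := exists_path_out hac ha hc
  have hpq : p ++ q ≠ [] := by simp [hp]
  have ht : E.IsTrail (p ++ q) := by
    refine ⟨hpq, ?_, ?_, ?_, ?_⟩
    · rw [List.isChain_append]
      refine ⟨p1, q1, ?_⟩
      intro x hx y hy
      rw [List.getLast?_eq_some_getLast hp] at hx
      rw [List.head?_eq_some_head hq] at hy
      simp only [Option.mem_def, Option.some.injEq] at hx hy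
      rw [← hx, ← hy, p3, q2]
    · rw [List.head_append_of_ne_nil hp]
      exact onSourceCycle_of_exit hE hN
        (fun hcyc => p4 _ (List.head_mem hp) hcyc.onClosedPath_range) p2
    · rw [List.getLast_append_of_ne_nil hpq hq]
      exact onSinkCycle_of_entry hE hN (fun hcyc => q4 hcyc.onClosedPath) q3
    · intro e he
      rw [List.dropLast_append_of_ne_nil hq] at he
      have : ¬ E.OnClosedPath (E.r e) := (List.mem_append.1 he).elim (p4 e) (q5 e)
      exact ⟨fun h => this h.onClosedPath, fun h => this h.onClosedPath⟩
  have h1 := h.2.1 _ ht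
  rw [List.length_append] at h1
  have h2 := List.length_pos_iff.2 hp
  have h3 := List.length_pos_iff.2 hq
  omega

lemma onSourceCycle_s {e : E.Edge} (he : ¬ E.IsCyclic e) : E.OnSourceCycle (E.s e) :=
  onSourceCycle_of_exit h.essential h.noDoubleExit he (h.onClosedPath _)

lemma onSinkCycle_r {e : E.Edge} (he : ¬ E.IsCyclic e) : E.OnSinkCycle (E.r e) :=
  onSinkCycle_of_entry h.essential h.noDoubleExit he (h.onClosedPath _)

lemma not_onSourceCycle_iff {a : E.V} : ¬ E.OnSourceCycle a ↔ E.OnSinkCycle a := by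
  have hE := h.essential
  have hN := h.noDoubleExit
  have hmem := mem_cycleAt_verts hE hN a (h.onClosedPath a)
  rw [onSourceCycle_iff hE hN _ hmem, onSinkCycle_iff hE hN _ hmem]
  exact ⟨fun hs => (h.1.isSource_or_isSink _).resolve_left hs,
    Cycle.not_isSource_of_isSink hE hN _⟩

lemma onSourceCycle_r_iff {e : E.Edge} (he : E.IsCyclic e) :
    E.OnSourceCycle (E.r e) ↔ E.OnSourceCycle (E.s e) := by
  have hE := h.essential
  have hN := h.noDoubleExit
  have hmem := mem_cycleAt_verts hE hN _ he.onClosedPath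
  rw [onSourceCycle_iff hE hN _ hmem, onSourceCycle_iff hE hN _ (Cycle.r_mem_verts hE hN _ he hmem)]

/-- The trails of a graph in normal form are the edges that lie on no cycle. -/
lemma isTrail_iff {p : List E.Edge} : E.IsTrail p ↔ ∃ e, ¬ E.IsCyclic e ∧ p = [e] := by
  constructor
  · intro hp
    obtain ⟨e, rfl⟩ := List.length_eq_one_iff.1 (h.2.1 p hp)
    refine ⟨e, fun he => ?_, rfl⟩
    have h1 : E.OnSourceCycle (E.s e) := hp.source
    have h2 : E.OnSinkCycle (E.r e) := hp.range
    exact h.not_onSourceCycle_iff.2 h2 ((h.onSourceCycle_r_iff he).2 h1)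
  · rintro ⟨e, he, rfl⟩
    exact ⟨by simp, by simp, h.onSourceCycle_s he, h.onSinkCycle_r he, by simp⟩

lemma onSourceCycle_next_iff (a : E.V) :
    E.OnSourceCycle (next h.essential h.noDoubleExit a) ↔ E.OnSourceCycle a := by
  have hc := isCyclic_outEdge h.essential (h.onClosedPath a)
  have := h.onSourceCycle_r_iff hc
  rwa [s_outEdge, ← next_apply h.essential h.noDoubleExit (h.onClosedPath a)] at this

/-- The permutation of the vertices on source cycles, one step along the cycles. -/
noncomputable def sourcePerm : Equiv.Perm {a : E.V // E.OnSourceCycle a} :=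
  (next h.essential h.noDoubleExit).subtypePerm h.onSourceCycle_next_iff

/-- The permutation of the remaining vertices, which are those on sink cycles. -/
noncomputable def sinkPerm : Equiv.Perm {a : E.V // ¬ E.OnSourceCycle a} :=
  (next h.essential h.noDoubleExit).subtypePerm fun a => not_congr (h.onSourceCycle_next_iff a)

/-- Source and range of an edge that lies on no cycle. -/
def trailEnds (e : {e : E.Edge // ¬ E.IsCyclic e}) :
    {a : E.V // E.OnSourceCycle a} × {a : E.V // ¬ E.OnSourceCycle a} :=
  (⟨E.s e.1, h.onSourceCycle_s e.2⟩, ⟨E.r e.1, h.not_onSourceCycle_iff.2 (h.onSinkCycle_r e.2)⟩)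

lemma sourcePerm_zpow_coe (n : ℤ) (x : {a : E.V // E.OnSourceCycle a}) :
    ((h.sourcePerm ^ n) x : E.V) = (next h.essential h.noDoubleExit ^ n) x := by
  rw [sourcePerm, Equiv.Perm.subtypePerm_zpow]
  rfl

lemma sinkPerm_zpow_coe (n : ℤ) (x : {a : E.V // ¬ E.OnSourceCycle a}) :
    ((h.sinkPerm ^ n) x : E.V) = (next h.essential h.noDoubleExit ^ n) x := by
  rw [sinkPerm, Equiv.Perm.subtypePerm_zpow]
  rfl

open Classical in
lemma card_edges_of_cyclic {a b : E.V}
    (hab : ∀ e, E.s e = a → E.r e = b → E.IsCyclic e) :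
    Nat.card {e : E.Edge // E.s e = a ∧ E.r e = b} =
      if next h.essential h.noDoubleExit a = b then 1 else 0 := by
  have hE := h.essential
  have hN := h.noDoubleExit
  split_ifs with hnext
  · rw [Nat.card_eq_one_iff_exists]
    rw [next_apply hE hN (h.onClosedPath a)] at hnext
    refine ⟨⟨outEdge hE a, s_outEdge hE a, hnext⟩, ?_⟩
    rintro ⟨e, rfl, h2⟩
    exact Subtype.ext ((hab e rfl h2).eq_outEdge hE hN).symm
  · have : IsEmpty {e : E.Edge // E.s e = a ∧ E.r e = b} := ⟨by
      rintro ⟨e, rfl, h2⟩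
      exact hnext ((next_source hE hN (hab e rfl h2)).trans h2)⟩
    exact Nat.card_of_isEmpty

open Classical in
/-- The adjacency matrix of a graph in normal form, in block form. -/
lemma strongShiftEquiv_layered :
    StrongShiftEquiv E.adj (layered h.sourcePerm h.sinkPerm (countMat h.trailEnds)) := by
  refine StrongShiftEquiv.symm (ElemShiftEquiv.strong (elemShiftEquiv_of_reindex
    (A := layered h.sourcePerm h.sinkPerm (countMat h.trailEnds)) (B := E.adj)
    (Equiv.sumCompl E.OnSourceCycle) ?_))
  have hcyc : ∀ e, (E.OnSourceCycle (E.s e) ↔ E.OnSourceCycle (E.r e)) → E.IsCyclic e := by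
    intro e he
    by_contra hcon
    exact h.not_onSourceCycle_iff.2 (h.onSinkCycle_r hcon) (he.1 (h.onSourceCycle_s hcon))
  rintro (⟨a, ha⟩ | ⟨a, ha⟩) (⟨b, hb⟩ | ⟨b, hb⟩)
  · change Nat.card {e : E.Edge // E.s e = a ∧ E.r e = b} =
      permMat h.sourcePerm ⟨a, ha⟩ ⟨b, hb⟩
    rw [h.card_edges_of_cyclic, permMat_apply]
    · simp only [Subtype.ext_iff]
      rfl
    · rintro e rfl rfl
      exact hcyc e (iff_of_true ha hb)
  · change Nat.card {e : E.Edge // E.s e = a ∧ E.r e = b} =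
      Nat.card {n // h.trailEnds n = (⟨a, ha⟩, ⟨b, hb⟩)}
    refine Nat.card_congr
      { toFun := fun e => ⟨⟨e.1, fun he => hb ?_⟩, ?_⟩
        invFun := fun n => ⟨n.1.1, congrArg (fun x => x.1.1) n.2, congrArg (fun x => x.2.1) n.2⟩
        left_inv := fun e => rfl
        right_inv := fun n => rfl }
    · have := (h.onSourceCycle_r_iff he).2
      rw [e.2.1, e.2.2] at this
      exact this ha
    · obtain ⟨e, rfl, rfl⟩ := e
      rfl
  · change Nat.card {e : E.Edge // E.s e = a ∧ E.r e = b} = 0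
    have : IsEmpty {e : E.Edge // E.s e = a ∧ E.r e = b} := ⟨by
      rintro ⟨e, rfl, rfl⟩
      by_cases he : E.IsCyclic e
      · exact ha ((h.onSourceCycle_r_iff he).1 hb)
      · exact ha (h.onSourceCycle_s he)⟩
    exact Nat.card_of_isEmpty
  · change Nat.card {e : E.Edge // E.s e = a ∧ E.r e = b} =
      permMat h.sinkPerm ⟨a, ha⟩ ⟨b, hb⟩
    rw [h.card_edges_of_cyclic, permMat_apply]
    · simp only [Subtype.ext_iff]
      rfl
    · rintro e rfl rfl
      exact hcyc e (iff_of_false ha hb)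

lemma exists_trailEnds_eq (x : {a : E.V // E.OnSourceCycle a}) :
    ∃ (i : ℕ) (n : {e : E.Edge // ¬ E.IsCyclic e}),
      (h.trailEnds n).1 = (h.sourcePerm ^ i) x := by
  have hE := h.essential
  have hN := h.noDoubleExit
  obtain ⟨a, C, hC, k, rfl⟩ := x
  obtain ⟨e, ⟨l, hl⟩, he⟩ := (C.isSource_iff hE hN).1 hC
  refine ⟨(l - k).val, ⟨e, he⟩, Subtype.ext ?_⟩
  have h1 := C.next_zpow_vertex hE hN k ((l - k).val : ℕ)
  have h2 := h.sourcePerm_zpow_coe ((l - k).val : ℕ) ⟨C.vertex k, C, hC, k, rfl⟩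
  rw [zpow_natCast] at h2
  rw [h2, h1, Int.cast_natCast, ZMod.natCast_zmod_val, add_sub_cancel, hl]
  rfl

open Classical in
lemma strongShiftEquiv_iff_orbitEquiv {F : FinGraph.{u}} (hF : F.InNormalForm K) :
    StrongShiftEquiv E.adj F.adj ↔
      OrbitEquiv h.sourcePerm h.sinkPerm h.trailEnds hF.sourcePerm hF.sinkPerm hF.trailEnds := by
  constructor
  · intro hEF
    exact StrongShiftEquiv.orbitEquiv h.exists_trailEnds_eq hF.exists_trailEnds_eq
      ((h.strongShiftEquiv_layered.symm.trans hEF).trans hF.strongShiftEquiv_layered)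
  · intro hEF
    exact (h.strongShiftEquiv_layered.trans hEF.strongShiftEquiv).trans
      hF.strongShiftEquiv_layered.symm

end InNormalForm

end FinGraph

/-! ### Orbits of pairs of vertices and trail counts -/

section
variable {α β : Type*}

lemma sameCycle_prodCongr_iff (σ : Equiv.Perm α) (τ : Equiv.Perm β) (x x' : α) (y y' : β) :
    SameCycle (Equiv.prodCongr σ τ : Equiv.Perm (α × β)) (x, y) (x', y') ↔
      ∃ n : ℤ, (σ ^ n) x = x' ∧ (τ ^ n) y = y' := by
  have h : ∀ n : ℤ, (Equiv.prodCongr σ τ : Equiv.Perm (α × β)) ^ n =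
      (Equiv.prodCongr (σ ^ n) (τ ^ n) : Equiv.Perm (α × β)) := by
    intro n
    induction n using Int.induction_on with
    | zero => ext <;> rfl
    | succ n ih => rw [zpow_add_one, ih]; ext <;> rfl
    | pred n ih => rw [zpow_sub_one, zpow_sub_one, zpow_sub_one, ih]; ext <;> rfl
  simp only [SameCycle, h, Equiv.prodCongr_apply, Prod.map_apply, Prod.mk.injEq]

lemma zpow_apply_of_semiconj {f : Equiv.Perm α} {g : Equiv.Perm β} {θ : α ≃ β}
    (h : ∀ a, θ (f a) = g (θ a)) (n : ℤ) (a : α) : θ ((f ^ n) a) = (g ^ n) (θ a) := by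
  induction n using Int.induction_on generalizing a with
  | zero => rfl
  | succ n ih => rw [zpow_add_one, zpow_add_one, Equiv.Perm.mul_apply, Equiv.Perm.mul_apply, ih, h]
  | pred n ih =>
    rw [zpow_sub_one, zpow_sub_one, Equiv.Perm.mul_apply, Equiv.Perm.mul_apply, ih]
    congr 1
    rw [Equiv.Perm.eq_inv_iff_eq, ← h]
    exact congrArg θ (f.apply_symm_apply a)

lemma sameCycle_iff_of_semiconj {f : Equiv.Perm α} {g : Equiv.Perm β} {θ : α ≃ β}
    (h : ∀ a, θ (f a) = g (θ a)) (a b : α) : SameCycle g (θ a) (θ b) ↔ SameCycle f a b := by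
  simp only [SameCycle, ← zpow_apply_of_semiconj h, θ.injective.eq_iff]

end

/-- The Chinese remainder theorem for two moduli that need not be coprime. -/
lemma exists_modEq_modEq {p q : ℕ} {a b : ℤ} (h : a ≡ b [ZMOD (Nat.gcd p q : ℤ)]) :
    ∃ n : ℤ, n ≡ a [ZMOD p] ∧ n ≡ b [ZMOD q] := by
  obtain ⟨c, hc⟩ := h.dvd
  have hb := Nat.gcd_eq_gcd_ab p q
  refine ⟨a + p * (Nat.gcdA p q * c), ?_, ?_⟩
  · exact (Int.modEq_iff_dvd.2 ⟨Nat.gcdA p q * c, by ring⟩ : a ≡ _ [ZMOD p]).symm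
  · refine Int.modEq_iff_dvd.2 ⟨Nat.gcdB p q * c, ?_⟩
    rw [hb] at hc
    linear_combination hc

namespace FinGraph
open SqNatMatrix
variable {E : FinGraph.{u}}

lemma Cycle.vertex_intCast_eq_iff (C : E.Cycle) (k l : ℤ) :
    C.vertex (k : ZMod C.len) = C.vertex (l : ZMod C.len) ↔ k ≡ l [ZMOD C.len] := by
  rw [C.vertex_injective.eq_iff, ZMod.intCast_eq_intCast_iff]

lemma Cycle.exists_eq_vertex_intCast (C : E.Cycle) {a : E.V} (h : a ∈ C.verts) :
    ∃ k : ℤ, a = C.vertex (k : ZMod C.len) := by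
  obtain ⟨k, rfl⟩ := h
  obtain ⟨k, rfl⟩ := ZMod.intCast_surjective k
  exact ⟨k, rfl⟩

namespace InNormalForm
variable {K : Type v} [Field K] (h : E.InNormalForm K)
include h

lemma sourcePerm_zpow_vertex (C : E.Cycle) (k n : ℤ) {x : {a : E.V // E.OnSourceCycle a}}
    (hx : (x : E.V) = C.vertex (k : ZMod C.len)) :
    ((h.sourcePerm ^ n) x : E.V) = C.vertex ((k + n : ℤ) : ZMod C.len) := by
  rw [h.sourcePerm_zpow_coe, hx, C.next_zpow_vertex]
  push_cast
  rfl

lemma sinkPerm_zpow_vertex (C : E.Cycle) (k n : ℤ) {x : {a : E.V // ¬ E.OnSourceCycle a}}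
    (hx : (x : E.V) = C.vertex (k : ZMod C.len)) :
    ((h.sinkPerm ^ n) x : E.V) = C.vertex ((k + n : ℤ) : ZMod C.len) := by
  rw [h.sinkPerm_zpow_coe, hx, C.next_zpow_vertex]
  push_cast
  rfl

/-- The orbits of pairs of vertices on two cycles are the classes of the difference of the indices
modulo the greatest common divisor of the lengths. -/
lemma sameCycle_iff (C D : E.Cycle) {k l : ℤ} {x x' : {a : E.V // E.OnSourceCycle a}}
    {y y' : {a : E.V // ¬ E.OnSourceCycle a}} (hx : (x : E.V) = C.vertex (k : ZMod C.len))
    (hy : (y : E.V) = D.vertex (l : ZMod D.len)) :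
    SameCycle (Equiv.prodCongr h.sourcePerm h.sinkPerm : Equiv.Perm
      ({a : E.V // E.OnSourceCycle a} × {a : E.V // ¬ E.OnSourceCycle a})) (x, y) (x', y') ↔
      ∃ k' l' : ℤ, (x' : E.V) = C.vertex (k' : ZMod C.len) ∧
        (y' : E.V) = D.vertex (l' : ZMod D.len) ∧
        l' - k' ≡ l - k [ZMOD (Nat.gcd C.len D.len : ℤ)] := by
  rw [sameCycle_prodCongr_iff]
  constructor
  · rintro ⟨n, rfl, rfl⟩
    refine ⟨k + n, l + n, h.sourcePerm_zpow_vertex C k n hx, h.sinkPerm_zpow_vertex D l n hy, ?_⟩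
    rw [add_sub_add_right_eq_sub]
  · rintro ⟨k', l', hx', hy', hkl⟩
    obtain ⟨n, h1, h2⟩ := exists_modEq_modEq (p := C.len) (q := D.len) (a := k' - k) (b := l' - l)
      (Int.modEq_iff_dvd.2 (by
        have := hkl.symm.dvd
        convert this using 1
        ring))
    refine ⟨n, Subtype.ext ?_, Subtype.ext ?_⟩
    · rw [h.sourcePerm_zpow_vertex C k n hx, hx', C.vertex_intCast_eq_iff]
      have := h1.add_left k
      rwa [add_sub_cancel] at this
    · rw [h.sinkPerm_zpow_vertex D l n hy, hy', D.vertex_intCast_eq_iff]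
      have := h2.add_left l
      rwa [add_sub_cancel] at this

lemma exists_exit_index (C : E.Cycle) (hC : C.IsSource) :
    ∃ k : ℤ, ∀ e, ¬ E.IsCyclic e → E.s e ∈ C.verts → E.s e = C.vertex (k : ZMod C.len) := by
  obtain ⟨f, hf, hcf⟩ := (C.isSource_iff h.essential h.noDoubleExit).1 hC
  obtain ⟨k, hk⟩ := C.exists_eq_vertex_intCast hf
  refine ⟨k, fun e he hs => ?_⟩
  rw [← hk]
  exact h.2.2 C hC [e] [f] (h.isTrail_iff.2 ⟨e, he, rfl⟩) (h.isTrail_iff.2 ⟨f, hcf, rfl⟩) hs hf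

/-- The number of trails from `C` to `D` in a class modulo the greatest common divisor of the
lengths is the number of trails in the corresponding orbit. -/
lemma trailCount_eq (C D : E.Cycle) {k₀ k l c : ℤ}
    (hk₀ : ∀ e, ¬ E.IsCyclic e → E.s e ∈ C.verts → E.s e = C.vertex (k₀ : ZMod C.len))
    {x : {a : E.V // E.OnSourceCycle a}} {y : {a : E.V // ¬ E.OnSourceCycle a}}
    (hx : (x : E.V) = C.vertex (k : ZMod C.len)) (hy : (y : E.V) = D.vertex (l : ZMod D.len))
    (hc : c ≡ l - k + k₀ [ZMOD (Nat.gcd C.len D.len : ℤ)]) :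
    E.trailCount C D c = Nat.card {n // SameCycle (Equiv.prodCongr h.sourcePerm h.sinkPerm :
      Equiv.Perm ({a : E.V // E.OnSourceCycle a} × {a : E.V // ¬ E.OnSourceCycle a}))
      (h.trailEnds n) (x, y)} := by
  have key : ∀ n : {e : E.Edge // ¬ E.IsCyclic e},
      SameCycle (Equiv.prodCongr h.sourcePerm h.sinkPerm :
        Equiv.Perm ({a : E.V // E.OnSourceCycle a} × {a : E.V // ¬ E.OnSourceCycle a}))
        (h.trailEnds n) (x, y) ↔
      E.s n.1 ∈ C.verts ∧ ∃ l' : ℤ, E.r n.1 = D.vertex (l' : ZMod D.len) ∧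
        l' ≡ c [ZMOD (Nat.gcd C.len D.len : ℤ)] := by
    intro n
    have hgcd : (Nat.gcd C.len D.len : ℤ) ∣ C.len :=
      Int.natCast_dvd_natCast.2 (Nat.gcd_dvd_left _ _)
    rw [Equiv.Perm.sameCycle_comm]
    change SameCycle _ (x, y) (⟨E.s n.1, _⟩, ⟨E.r n.1, _⟩) ↔ _
    rw [h.sameCycle_iff C D hx hy]
    constructor
    · rintro ⟨k', l', h1, h2, h3⟩
      have h1 : E.s n.1 = C.vertex (k' : ZMod C.len) := h1
      have hmem : E.s n.1 ∈ C.verts := h1 ▸ C.vertex_mem _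
      refine ⟨hmem, l', h2, ?_⟩
      have h4 : k' ≡ k₀ [ZMOD (Nat.gcd C.len D.len : ℤ)] :=
        ((C.vertex_intCast_eq_iff k' k₀).1 (h1.symm.trans (hk₀ _ n.2 hmem))).of_dvd hgcd
      have h5 := h3.add h4
      rw [sub_add_cancel] at h5
      exact h5.trans hc.symm
    · rintro ⟨hmem, l', h2, h3⟩
      refine ⟨k₀, l', hk₀ _ n.2 hmem, h2, ?_⟩
      have := (h3.trans hc).sub_right k₀
      rwa [add_sub_cancel_right] at this
  unfold trailCount
  rw [← Nat.card_coe_set_eq]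
  symm
  refine Nat.card_eq_of_bijective (fun n => ⟨[n.1.1], h.isTrail_iff.2 ⟨n.1.1, n.1.2, rfl⟩,
    (key n.1).1 n.2⟩) ⟨?_, ?_⟩
  · intro n n' hnn
    have := congrArg Subtype.val hnn
    exact Subtype.ext (Subtype.ext (List.singleton_injective this))
  · rintro ⟨p, hp, h1, h2⟩
    obtain ⟨e, he, rfl⟩ := h.isTrail_iff.1 hp
    exact ⟨⟨⟨e, he⟩, (key ⟨e, he⟩).2 ⟨h1, h2⟩⟩, rfl⟩

end InNormalForm

/-! ### From bijections of the layers to numberings of the cycles -/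

namespace InNormalForm
variable {K : Type v} [Field K] (h : E.InNormalForm K)
include h

lemma sameCycle_iff_mem_verts (C : E.Cycle) {a b : E.V} (ha : a ∈ C.verts) :
    SameCycle (next h.essential h.noDoubleExit) a b ↔ b ∈ C.verts := by
  obtain ⟨k, rfl⟩ := ha
  constructor
  · rintro ⟨n, rfl⟩
    rw [C.next_zpow_vertex]
    exact C.vertex_mem _
  · intro hb
    obtain ⟨k, rfl⟩ := ZMod.intCast_surjective k
    obtain ⟨l, rfl⟩ := C.exists_eq_vertex_intCast hb
    refine ⟨l - k, ?_⟩
    rw [C.next_zpow_vertex]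
    push_cast
    rw [add_sub_cancel]

/-- The cycle through a vertex of a graph in normal form. -/
noncomputable def cycle (a : E.V) : E.Cycle :=
  cycleAt h.essential h.noDoubleExit a (h.onClosedPath a)

lemma cycle_vertex_zero (a : E.V) : (h.cycle a).vertex 0 = a := cycleAt_vertex_zero _ _ a _

lemma mem_cycle_verts (a : E.V) : a ∈ (h.cycle a).verts := mem_cycleAt_verts _ _ a _

lemma isSource_cycle_iff (a : E.V) : (h.cycle a).IsSource ↔ E.OnSourceCycle a :=
  (onSourceCycle_iff h.essential h.noDoubleExit _ (h.mem_cycle_verts a)).symm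

lemma isSink_cycle_iff (a : E.V) : (h.cycle a).IsSink ↔ ¬ E.OnSourceCycle a :=
  (onSinkCycle_iff h.essential h.noDoubleExit _ (h.mem_cycle_verts a)).symm.trans
    h.not_onSourceCycle_iff.symm

lemma same_cycle_iff (a : E.V) (X : E.Cycle) :
    (h.cycle a).Same X ↔ SameCycle (next h.essential h.noDoubleExit) a (X.vertex 0) := by
  rw [h.sameCycle_iff_mem_verts _ (h.mem_cycle_verts a)]
  constructor
  · intro hs
    rw [hs.verts_eq]
    exact X.vertex_mem 0
  · intro hm
    exact Cycle.same_of_mem h.essential h.noDoubleExit _ X hm (X.vertex_mem 0)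

/-- Representatives of the orbits of the two layers number the source and the sink cycles. -/
lemma isPointing_cycle {m n : ℕ} (x : Fin m → {a : E.V // E.OnSourceCycle a})
    (y : Fin n → {a : E.V // ¬ E.OnSourceCycle a})
    (hx : ∀ a, ∃! i, SameCycle h.sourcePerm (x i) a)
    (hy : ∀ a, ∃! j, SameCycle h.sinkPerm (y j) a) :
    E.IsPointing (fun i => h.cycle (x i)) (fun j => h.cycle (y j)) where
  isSource i := (h.isSource_cycle_iff _).2 (x i).2
  isSink j := (h.isSink_cycle_iff _).2 (y j).2
  all_sources X hX := by
    have hX0 : E.OnSourceCycle (X.vertex 0) := ⟨X, hX, X.vertex_mem 0⟩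
    simpa only [h.same_cycle_iff, sourcePerm, Equiv.Perm.sameCycle_subtypePerm] using
      hx ⟨X.vertex 0, hX0⟩
  all_sinks X hX := by
    have hX0 : ¬ E.OnSourceCycle (X.vertex 0) :=
      h.not_onSourceCycle_iff.2 ⟨X, hX, X.vertex_mem 0⟩
    simpa only [h.same_cycle_iff, sinkPerm, Equiv.Perm.sameCycle_subtypePerm] using
      hy ⟨X.vertex 0, hX0⟩

lemma len_cycle (a : E.V) :
    (h.cycle a).len = Function.minimalPeriod (next h.essential h.noDoubleExit) a := rfl

lemma len_cycle_source (x : {a : E.V // E.OnSourceCycle a}) :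
    (h.cycle x).len = Function.minimalPeriod h.sourcePerm x := by
  rw [h.len_cycle, Function.minimalPeriod_eq_minimalPeriod_iff]
  intro n
  have := h.sourcePerm_zpow_coe n x
  rw [zpow_natCast, zpow_natCast] at this
  rw [Function.IsPeriodicPt, Function.IsPeriodicPt, Function.IsFixedPt, Function.IsFixedPt,
    Equiv.Perm.iterate_eq_pow, Equiv.Perm.iterate_eq_pow, Subtype.ext_iff, this]

lemma len_cycle_sink (x : {a : E.V // ¬ E.OnSourceCycle a}) :
    (h.cycle x).len = Function.minimalPeriod h.sinkPerm x := by
  rw [h.len_cycle, Function.minimalPeriod_eq_minimalPeriod_iff]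
  intro n
  have := h.sinkPerm_zpow_coe n x
  rw [zpow_natCast, zpow_natCast] at this
  rw [Function.IsPeriodicPt, Function.IsPeriodicPt, Function.IsFixedPt, Function.IsFixedPt,
    Equiv.Perm.iterate_eq_pow, Equiv.Perm.iterate_eq_pow, Subtype.ext_iff, this]

lemma coe_sourcePerm_zpow_cycle (x : {a : E.V // E.OnSourceCycle a}) (n : ℤ) :
    ((h.sourcePerm ^ n) x : E.V) = (h.cycle x).vertex (n : ZMod (h.cycle x).len) := by
  have := h.sourcePerm_zpow_vertex (h.cycle x) 0 n (x := x)
    (by rw [Int.cast_zero, h.cycle_vertex_zero])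
  rwa [zero_add] at this

lemma coe_sinkPerm_zpow_cycle (x : {a : E.V // ¬ E.OnSourceCycle a}) (n : ℤ) :
    ((h.sinkPerm ^ n) x : E.V) = (h.cycle x).vertex (n : ZMod (h.cycle x).len) := by
  have := h.sinkPerm_zpow_vertex (h.cycle x) 0 n (x := x)
    (by rw [Int.cast_zero, h.cycle_vertex_zero])
  rwa [zero_add] at this

end InNormalForm

lemma exists_orbit_representatives {α : Type*} [Finite α] (f : Equiv.Perm α) :
    ∃ (m : ℕ) (x : Fin m → α), ∀ a, ∃! i, SameCycle f (x i) a := by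
  obtain ⟨m, ⟨e⟩⟩ := Finite.exists_equiv_fin (Quotient (SameCycle.setoid f))
  refine ⟨m, fun i => (e.symm i).out, fun a => ⟨e (Quotient.mk _ a), ?_, ?_⟩⟩
  · simp only [Equiv.symm_apply_apply]
    exact Quotient.exact (Quotient.out_eq (Quotient.mk (SameCycle.setoid f) a))
  · intro i hi
    rw [← e.symm_apply_eq, ← Quotient.out_eq (e.symm i)]
    exact Quotient.sound hi

lemma minimalPeriod_eq_of_semiconj {α β : Type*} {f : Equiv.Perm α} {g : Equiv.Perm β} {θ : α ≃ β}
    (h : ∀ a, θ (f a) = g (θ a)) (a : α) :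
    Function.minimalPeriod f a = Function.minimalPeriod g (θ a) := by
  rw [Function.minimalPeriod_eq_minimalPeriod_iff]
  intro n
  have := zpow_apply_of_semiconj h n a
  rw [zpow_natCast, zpow_natCast] at this
  rw [Function.IsPeriodicPt, Function.IsPeriodicPt, Function.IsFixedPt, Function.IsFixedPt,
    Equiv.Perm.iterate_eq_pow, Equiv.Perm.iterate_eq_pow, ← this, θ.injective.eq_iff]

lemma existsUnique_sameCycle_of_semiconj {ι α β : Type*} {f : Equiv.Perm α} {g : Equiv.Perm β}
    {θ : α ≃ β} (h : ∀ a, θ (f a) = g (θ a)) {x : ι → α} (hx : ∀ a, ∃! i, SameCycle f (x i) a)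
    (b : β) : ∃! i, SameCycle g (θ (x i)) b := by
  obtain ⟨a, rfl⟩ := θ.surjective b
  simpa only [sameCycle_iff_of_semiconj h] using hx a

variable {F : FinGraph.{u}} {K : Type v} [Field K]

lemma InNormalForm.approx_of_orbitEquiv (hE : E.InNormalForm K) (hF : F.InNormalForm K)
    (h : OrbitEquiv hE.sourcePerm hE.sinkPerm hE.trailEnds
      hF.sourcePerm hF.sinkPerm hF.trailEnds) : E.Approx F := by
  obtain ⟨ρ, κ, hρ, hκ, hz⟩ := h
  obtain ⟨m, x, hx⟩ := exists_orbit_representatives hE.sourcePerm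
  obtain ⟨n, y, hy⟩ := exists_orbit_representatives hE.sinkPerm
  have hθ : ∀ a, Equiv.prodCongr ρ κ (Equiv.prodCongr hE.sourcePerm hE.sinkPerm a) =
      Equiv.prodCongr hF.sourcePerm hF.sinkPerm (Equiv.prodCongr ρ κ a) := by
    rintro ⟨a, b⟩
    exact Prod.ext (hρ a) (hκ b)
  choose k hk using fun i => hE.exists_exit_index (hE.cycle (x i))
    ((hE.isSource_cycle_iff _).2 (x i).2)
  choose k' hk' using fun i => hF.exists_exit_index (hF.cycle (ρ (x i)))
    ((hF.isSource_cycle_iff _).2 (ρ (x i)).2)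
  refine ⟨m, n, fun i => hE.cycle (x i), fun j => hE.cycle (y j), fun i => hF.cycle (ρ (x i)),
    fun j => hF.cycle (κ (y j)), hE.isPointing_cycle x y hx hy,
    hF.isPointing_cycle _ _ (existsUnique_sameCycle_of_semiconj hρ hx)
      (existsUnique_sameCycle_of_semiconj hκ hy),
    fun i => k' i - k i, fun _ => 0, fun i => ?_, fun j => ?_, fun c i j => ?_⟩
  · rw [hE.len_cycle_source, hF.len_cycle_source, minimalPeriod_eq_of_semiconj hρ]
  · rw [hE.len_cycle_sink, hF.len_cycle_sink, minimalPeriod_eq_of_semiconj hκ]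
  · have e1 := hE.trailCount_eq (hE.cycle (x i)) (hE.cycle (y j)) (k₀ := k i) (k := k i)
      (l := c) (c := c) (hk i) (hE.coe_sourcePerm_zpow_cycle (x i) _)
      (hE.coe_sinkPerm_zpow_cycle (y j) _) (by rw [sub_add_cancel])
    have e2 := hF.trailCount_eq (hF.cycle (ρ (x i))) (hF.cycle (κ (y j))) (k₀ := k' i)
      (k := k i) (l := c) (c := c + (k' i - k i) + 0) (hk' i)
      (hF.coe_sourcePerm_zpow_cycle (ρ (x i)) _)
      (hF.coe_sinkPerm_zpow_cycle (κ (y j)) _) (by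
        have : (c : ℤ) + (k' i - k i) + 0 = c - k i + k' i := by ring
        rw [this])
    rw [e1, e2, ← hz, ← zpow_apply_of_semiconj hρ, ← zpow_apply_of_semiconj hκ]
    refine Nat.card_congr (Equiv.subtypeEquivRight fun e => ?_)
    exact (sameCycle_iff_of_semiconj (θ := Equiv.prodCongr ρ κ) hθ (hE.trailEnds e) (_, _)).symm

/-! ### From numberings of the cycles to bijections of the layers -/

/-- Two sets of vertices that are disjoint unions of correspondingly numbered cycles of equal
lengths are in bijection; the cycles may be rotated against each other. -/
lemma exists_equiv_of_cycles {m : ℕ} {p : E.V → Prop} {p' : F.V → Prop} {C : Fin m → E.Cycle}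
    {C' : Fin m → F.Cycle} (hp : ∀ a, p a ↔ ∃ i, a ∈ (C i).verts)
    (hC : ∀ i j a, a ∈ (C i).verts → a ∈ (C j).verts → i = j)
    (hp' : ∀ a, p' a ↔ ∃ i, a ∈ (C' i).verts)
    (hC' : ∀ i j a, a ∈ (C' i).verts → a ∈ (C' j).verts → i = j)
    (hlen : ∀ i, (C i).len = (C' i).len) (t : Fin m → ℤ) :
    ∃ ρ : {a // p a} ≃ {a // p' a}, ∀ (i : Fin m) (k : ℤ) (x : {a // p a}),
      (x : E.V) = (C i).vertex (k : ZMod (C i).len) →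
        (ρ x : F.V) = (C' i).vertex ((k + t i : ℤ) : ZMod (C' i).len) := by
  have aux : ∀ {G : FinGraph.{u}} {p : G.V → Prop} {C : Fin m → G.Cycle}
      (hp : ∀ a, p a ↔ ∃ i, a ∈ (C i).verts)
      (_ : ∀ i j a, a ∈ (C i).verts → a ∈ (C j).verts → i = j),
      Function.Bijective (fun z : Σ i, ZMod (C i).len =>
        (⟨(C z.1).vertex z.2, (hp _).2 ⟨z.1, (C z.1).vertex_mem z.2⟩⟩ : {a // p a})) := by
    intro G p C hp hC
    constructor
    · rintro ⟨i, k⟩ ⟨j, l⟩ hij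
      have hij : (C i).vertex k = (C j).vertex l := congrArg Subtype.val hij
      obtain rfl := hC i j _ ((C i).vertex_mem k) (hij ▸ (C j).vertex_mem l)
      rw [(C i).vertex_injective hij]
    · rintro ⟨a, ha⟩
      obtain ⟨i, k, rfl⟩ := (hp a).1 ha
      exact ⟨⟨i, k⟩, rfl⟩
  let e := Equiv.ofBijective _ (aux hp hC)
  let e' := Equiv.ofBijective _ (aux hp' hC')
  refine ⟨(e.symm.trans (Equiv.sigmaCongrRight fun i =>
    (ZMod.ringEquivCongr (hlen i)).toEquiv.trans (Equiv.addRight (t i : ZMod (C' i).len)))).trans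
      e', fun i k x hx => ?_⟩
  have hx' : x = e ⟨i, k⟩ := Subtype.ext hx
  subst hx'
  simp only [Equiv.trans_apply, Equiv.symm_apply_apply]
  change (C' i).vertex (ZMod.ringEquivCongr (hlen i) (k : ZMod (C i).len) + _) = _
  rw [map_intCast]
  push_cast
  rfl

section IsPointing
variable {m n : ℕ} {C : Fin m → E.Cycle} {D : Fin n → E.Cycle}

lemma IsPointing.onSourceCycle_iff (hP : E.IsPointing C D) (a : E.V) :
    E.OnSourceCycle a ↔ ∃ i, a ∈ (C i).verts := by
  constructor
  · rintro ⟨X, hX, ha⟩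
    obtain ⟨i, hi, _⟩ := hP.all_sources X hX
    exact ⟨i, hi.verts_eq ▸ ha⟩
  · rintro ⟨i, hi⟩
    exact ⟨C i, hP.isSource i, hi⟩

lemma IsPointing.onSinkCycle_iff (hP : E.IsPointing C D) (a : E.V) :
    E.OnSinkCycle a ↔ ∃ j, a ∈ (D j).verts := by
  constructor
  · rintro ⟨X, hX, ha⟩
    obtain ⟨i, hi, _⟩ := hP.all_sinks X hX
    exact ⟨i, hi.verts_eq ▸ ha⟩
  · rintro ⟨i, hi⟩
    exact ⟨D i, hP.isSink i, hi⟩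

lemma IsPointing.source_index_unique (hP : E.IsPointing C D) (hE : E.InNormalForm K)
    (i j : Fin m) (a : E.V) (hi : a ∈ (C i).verts) (hj : a ∈ (C j).verts) : i = j :=
  (hP.all_sources (C i) (hP.isSource i)).unique rfl
    (Cycle.same_of_mem hE.essential hE.noDoubleExit _ _ hj hi)

lemma IsPointing.sink_index_unique (hP : E.IsPointing C D) (hE : E.InNormalForm K)
    (i j : Fin n) (a : E.V) (hi : a ∈ (D i).verts) (hj : a ∈ (D j).verts) : i = j :=
  (hP.all_sinks (D i) (hP.isSink i)).unique rfl
    (Cycle.same_of_mem hE.essential hE.noDoubleExit _ _ hj hi)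

end IsPointing

lemma InNormalForm.orbitEquiv_of_approx (hE : E.InNormalForm K) (hF : F.InNormalForm K)
    (h : E.Approx F) : OrbitEquiv hE.sourcePerm hE.sinkPerm hE.trailEnds
      hF.sourcePerm hF.sinkPerm hF.trailEnds := by
  obtain ⟨m, n, C, D, C', D', hP, hP', a, b, hC, hD, hcount⟩ := h
  choose k hk using fun i => hE.exists_exit_index (C i) (hP.isSource i)
  choose k' hk' using fun i => hF.exists_exit_index (C' i) (hP'.isSource i)
  -- the rotations make up for the different places at which trails leave the source cycles
  obtain ⟨ρ, hρ⟩ := exists_equiv_of_cycles hP.onSourceCycle_iff (hP.source_index_unique hE)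
    hP'.onSourceCycle_iff (hP'.source_index_unique hF) hC (fun i => k' i - k i - a i)
  obtain ⟨κ, hκ⟩ := exists_equiv_of_cycles
    (fun a => hE.not_onSourceCycle_iff.trans (hP.onSinkCycle_iff a)) (hP.sink_index_unique hE)
    (fun a => hF.not_onSourceCycle_iff.trans (hP'.onSinkCycle_iff a)) (hP'.sink_index_unique hF)
    hD b
  have hS : ∀ x : {a : E.V // E.OnSourceCycle a}, ∃ (i : Fin m) (l : ℤ),
      (x : E.V) = (C i).vertex (l : ZMod (C i).len) := by
    intro x
    obtain ⟨i, hi⟩ := (hP.onSourceCycle_iff _).1 x.2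
    exact ⟨i, (C i).exists_eq_vertex_intCast hi⟩
  have hT : ∀ y : {a : E.V // ¬ E.OnSourceCycle a}, ∃ (j : Fin n) (l : ℤ),
      (y : E.V) = (D j).vertex (l : ZMod (D j).len) := by
    intro y
    obtain ⟨j, hj⟩ := (hP.onSinkCycle_iff _).1 (hE.not_onSourceCycle_iff.1 y.2)
    exact ⟨j, (D j).exists_eq_vertex_intCast hj⟩
  have hρ' : ∀ x, ρ (hE.sourcePerm x) = hF.sourcePerm (ρ x) := by
    intro x
    obtain ⟨i, l, hx⟩ := hS x
    have h1 := hE.sourcePerm_zpow_vertex (C i) l 1 hx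
    have h2 := hF.sourcePerm_zpow_vertex (C' i) _ 1 (hρ i l x hx)
    rw [zpow_one] at h1 h2
    have h3 := hρ i _ _ h1
    rw [add_right_comm] at h3
    exact Subtype.ext (h3.trans h2.symm)
  have hκ' : ∀ y, κ (hE.sinkPerm y) = hF.sinkPerm (κ y) := by
    intro y
    obtain ⟨j, l, hy⟩ := hT y
    have h1 := hE.sinkPerm_zpow_vertex (D j) l 1 hy
    have h2 := hF.sinkPerm_zpow_vertex (D' j) _ 1 (hκ j l y hy)
    rw [zpow_one] at h1 h2
    have h3 := hκ j _ _ h1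
    rw [add_right_comm] at h3
    exact Subtype.ext (h3.trans h2.symm)
  have hθ : ∀ a, Equiv.prodCongr ρ κ (Equiv.prodCongr hE.sourcePerm hE.sinkPerm a) =
      Equiv.prodCongr hF.sourcePerm hF.sinkPerm (Equiv.prodCongr ρ κ a) := by
    rintro ⟨a, b⟩
    exact Prod.ext (hρ' a) (hκ' b)
  refine ⟨ρ, κ, hρ', hκ', ?_⟩
  rintro ⟨x', y'⟩
  obtain ⟨x, rfl⟩ := ρ.surjective x'
  obtain ⟨y, rfl⟩ := κ.surjective y'
  obtain ⟨i, l, hx⟩ := hS x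
  obtain ⟨j, r, hy⟩ := hT y
  -- a natural number in the residue class of `r - l + k i`
  obtain ⟨c, hc⟩ : ∃ c : ℕ, (c : ℤ) ≡ r - l + k i [ZMOD (Nat.gcd (C i).len (D j).len : ℤ)] := by
    have hpos : (0 : ℤ) < Nat.gcd (C i).len (D j).len :=
      Int.natCast_pos.2 (Nat.gcd_pos_of_pos_left _ (C i).len_pos)
    refine ⟨((r - l + k i) % (Nat.gcd (C i).len (D j).len : ℤ)).toNat, ?_⟩
    rw [Int.toNat_of_nonneg (Int.emod_nonneg _ hpos.ne')]
    exact Int.mod_modEq _ _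
  have e1 := hE.trailCount_eq (C i) (D j) (hk i) hx hy hc
  have e2 := hF.trailCount_eq (C' i) (D' j) (c := c + a i + b j) (hk' i) (hρ i l x hx)
    (hκ j r y hy) (by
      rw [← hC, ← hD]
      have := hc.add_right (a i + b j)
      convert this using 1 <;> ring)
  rw [← e2, ← hcount, e1]
  refine Nat.card_congr (Equiv.subtypeEquivRight fun e => ?_)
  exact sameCycle_iff_of_semiconj (θ := Equiv.prodCongr ρ κ) hθ (hE.trailEnds e) (x, y)

end FinGraph

theorem theorem3p12 (K : Type v) [Field K] (E F E' F' : FinGraph.{u})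
    (hE : E.IsGKThree K) (hF : F.IsGKThree K)
    (hE' : E'.InNormalForm K) (hF' : F'.InNormalForm K)
    (hEE' : E.ObtainedByMoves E') (hFF' : F.ObtainedByMoves F') :
    SqNatMatrix.StrongShiftEquiv E.adj F.adj ↔ E'.Approx F' := by
  have h : SqNatMatrix.StrongShiftEquiv E.adj F.adj ↔
      SqNatMatrix.StrongShiftEquiv E'.adj F'.adj :=
    ⟨fun h => (hEE'.strongShiftEquiv.symm.trans h).trans hFF'.strongShiftEquiv,
      fun h => (hEE'.strongShiftEquiv.trans h).trans hFF'.strongShiftEquiv.symm⟩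
  rw [h, hE'.strongShiftEquiv_iff_orbitEquiv hF']
  exact ⟨hE'.approx_of_orbitEquiv hF', hE'.orbitEquiv_of_approx hF'⟩
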